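/- Let $k,l\ge 1$, $g,h\ge 0$ be integers and let $a=\lambda_0<\lambda_1<\dots<\lambda_{g+1}=b$ and $c=\mu_0<\mu_1<\dots<\mu_{h+1}=d$ be knots, continued by $\lambda_i=a$, $\mu_i=c$ for $i<0$, $\lambda_i=b$ for $i>g+1$ and $\mu_j=d$ for $j>h+1$. Let $\Omega=[a,b]\times[c,d]$ and let $\mathcal S_{kl}(\Omega)$ be the space of tensor product splines on $\Omega$ with these knots, of degree $k$ in $x$ and $l$ in $y$: the finite sums $\sum_r p_r(x)q_r(y)$ in which each $p_r$ (each $q_r$) is a univariate spline of degree $k$ (of degree $l$) with simple knots, i.e. polynomial of degree at most $k$ (at most $l$) between consecutive knots and of class $C^{k-1}$ on $[a,b]$ ($C^{l-1}$ on $[c,d]$). Let $B_i^{r}$ be the B-splines of order $r$ (degree $r-1$) on the extended knot sequence $(\lambda_i)$, or $(\mu_j)$ when the variable is $y$, taken continuous from the left at $b$ and at $d$. Let $x_1,\dots,x_n\in[a,b]$, $y_1,\dots,y_m\in[c,d]$, $\mathbf F=(f_{ij})\in\mathbb R^{n\times m}$, $\alpha\in(0,1)$, $u\in\{0,\dots,k-1\}$,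 $v\in\{0,\dots,l-1\}$, and for $s\in\mathcal S_{kl}(\Omega)$ put $$J_{uv}(s)=\alpha\sum_{i=1}^n\sum_{j=1}^m\bigl[f_{ij}-s(x_i,y_j)\bigr]^2+(1-\alpha)\iint_\Omega\Bigl[\tfrac{\partial^u}{\partial x^u}\tfrac{\partial^v}{\partial y^v}s(x,y)\Bigr]^2\,dx\,dy .$$ Notation. $cs(\cdot)$ is columnwise vectorization, $\otimes$ the Kronecker product, $A^+$ the Moore–Penrose pseudoinverse. Let $\mathbf B_{k+1}(x)=(B_{-k}^{k+1}(x),\dots,B_g^{k+1}(x))$, $\mathbf B_{l+1}(y)=(B_{-l}^{l+1}(y),\dots,B_h^{l+1}(y))$ and $\mathbb B(x,y)=\mathbf B_{l+1}(y)\otimes\mathbf B_{k+1}(x)$, and let $\mathbb B=\mathbf B_{l+1}(\mathbf y)\otimes\mathbf B_{k+1}(\mathbf x)$ be formed with the collocation matrices at $\mathbf x=(x_1,\dots,x_n)$, $\mathbf y=(y_1,\dots,y_m)$. For $0\le j\le k-1$ let $\mathbf D_j^x=(k+1-j)\,\mathrm{diag}\bigl(1/(\lambda_{i+k+1-j}-\lambda_i)\bigr)_{i=-k+j}^{g}$;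 $\mathbf D_j^y$ is defined likewise for $0\le j\le l-1$ from $l,h,\mu$. Let $\mathbf D_x=\mathbf D^x_0$, $\mathbf D_y=\mathbf D^y_0$ and $\mathbb D=\mathbf D_y\otimes\mathbf D_x$. Let $\mathbf L_j^x\in\mathbb R^{(g+k+1-j)\times(g+k+2-j)}$ be bidiagonal with $-1$ on the diagonal and $1$ above it, $\mathbf K_x=\mathbf L_0^x$, and define $\mathbf L_j^y$, $\mathbf K_y=\mathbf L_0^y$ likewise from $l,h$. Let $\mathbb K=\mathbf K_y\otimes\mathbf K_x$. Let $\mathbf S_u=\mathbf D_u^x\mathbf L_u^x\cdots\mathbf D_1^x\mathbf L_1^x$, $\mathbf S_v=\mathbf D_v^y\mathbf L_v^y\cdots\mathbf D_1^y\mathbf L_1^y$ and $\mathbb S=\mathbf S_v\otimes\mathbf S_u$. Let $\mathbf M^x=\bigl(\int_a^b B_i^{k+1-u}B_j^{k+1-u}\,dx\bigr)_{i,j=-k+u}^{g}$, $\mathbf M^y=\bigl(\int_c^d B_i^{l+1-v}B_j^{l+1-v}\,dy\bigr)_{i,j=-l+v}^{h}$ and $\mathbb M=\mathbf M^y\otimes\mathbf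 M^x$. For $\mathbf C=(c_{ij})_{i=-k-1,\,j=-l-1}^{g,\,h}$ let $cs(\widetilde{\mathbf C})$ be $cs(\mathbf C)$ without its first entry $c_{-k-1,-l-1}$, and let $\widetilde{\mathbb K}$ be the matrix with $\widetilde{\mathbb K}\,cs(\widetilde{\mathbf C})=\mathbb K\,cs(\mathbf C)$ whenever $c_{-k-1,-l-1}=c_{-k-1,h}+c_{g,-l-1}-c_{g,h}$. Theorem. A spline $\mathbb B(x,y)\,cs(\mathbf B)$ with $\mathbf B\in\mathbb R^{(g+k+1)\times(h+l+1)}$ satisfies $\iint_\Omega \mathbb B(x,y)\,cs(\mathbf B)\,dx\,dy=0$ if and only if $cs(\mathbf B)=\mathbb D\,\widetilde{\mathbb K}\,cs(\widetilde{\mathbf C})$ for some $cs(\widetilde{\mathbf C})$. The spline $$s^*(x,y)=\mathbb B(x,y)\,\mathbb D\,\widetilde{\mathbb K}\,cs(\widetilde{\mathbf C^*}),\qquad cs(\widetilde{\mathbf C^*})=\Bigl[\widetilde{\mathbb K}^{\top}\mathbb D^{\top}\bigl[(1-\alpha)\,\mathbb S^{\top}\mathbb M\,\mathbb S+\alpha\,\mathbb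 B^{\top}\mathbb B\bigr]\mathbb D\,\widetilde{\mathbb K}\Bigr]^{+}\alpha\,\widetilde{\mathbb K}^{\top}\mathbb D^{\top}\mathbb B^{\top}cs(\mathbf F),$$ belongs to $\mathcal S_{kl}(\Omega)$, satisfies $\iint_\Omega s^*\,dx\,dy=0$, and minimizes $J_{uv}$ over all $s\in\mathcal S_{kl}(\Omega)$ with $\iint_\Omega s\,dx\,dy=0$. It is the only minimizer on $\Omega$ whenever $\sigma=0$ is the only $\sigma\in\mathcal S_{kl}(\Omega)$ with $\iint_\Omega\sigma=0$, $\sigma(x_i,y_j)=0$ for all $i,j$, and $\iint_\Omega[\partial_x^u\partial_y^v\sigma]^2=0$. -/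

import Mathlib

open Set MeasureTheory
open scoped Matrix Kronecker

noncomputable section

namespace TensorSpline

/-! ### The Moore-Penrose pseudoinverse of a real matrix -/

/-- The four Penrose equations: `X` is the Moore-Penrose pseudoinverse of `A`. -/
structure IsMoorePenroseInverse {m n : Type*} [Fintype m] [Fintype n]
    (A : Matrix m n ℝ) (X : Matrix n m ℝ) : Prop where
  mul_mul_self : A * X * A = A
  self_mul_mul : X * A * X = X
  left_symm : (A * X)ᵀ = A * X
  right_symm : (X * A)ᵀ = X * A

/-- A real matrix has at most one Moore-Penrose pseudoinverse. -/
theorem IsMoorePenroseInverse.unique {m n : Type*} [Fintype m] [Fintype n]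
    {A : Matrix m n ℝ} {X Y : Matrix n m ℝ}
    (hX : IsMoorePenroseInverse A X) (hY : IsMoorePenroseInverse A Y) : X = Y := by
  have h1 : A * X = A * Y := by
    calc A * X = (A * X)ᵀ := hX.left_symm.symm
      _ = ((A * Y * A) * X)ᵀ := by rw [hY.mul_mul_self]
      _ = ((A * Y) * (A * X))ᵀ := by simp only [Matrix.mul_assoc]
      _ = (A * X) * (A * Y) := by rw [Matrix.transpose_mul, hX.left_symm, hY.left_symm]
      _ = (A * X * A) * Y := by simp only [Matrix.mul_assoc]
      _ = A * Y := by rw [hX.mul_mul_self]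
  have h2 : X * A = Y * A := by
    calc X * A = (X * A)ᵀ := hX.right_symm.symm
      _ = (X * (A * Y * A))ᵀ := by rw [hY.mul_mul_self]
      _ = ((X * A) * (Y * A))ᵀ := by simp only [Matrix.mul_assoc]
      _ = (Y * A) * (X * A) := by rw [Matrix.transpose_mul, hX.right_symm, hY.right_symm]
      _ = Y * (A * X * A) := by simp only [Matrix.mul_assoc]
      _ = Y * A := by rw [hX.mul_mul_self]
  calc X = X * A * X := hX.self_mul_mul.symm
    _ = Y * (A * X) := by rw [h2, Matrix.mul_assoc]
    _ = Y * A * Y := by rw [h1, Matrix.mul_assoc]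
    _ = Y := hY.self_mul_mul

/-- Every real matrix has a Moore-Penrose pseudoinverse. -/
theorem exists_isMoorePenroseInverse {m n : Type*} [Fintype m] [Fintype n]
    (A : Matrix m n ℝ) : ∃ X : Matrix n m ℝ, IsMoorePenroseInverse A X := by
  classical
  obtain ⟨G, hG1, hG2, hG3, hG4⟩ : ∃ G : Matrix n n ℝ, (Aᵀ * A) * G * (Aᵀ * A) = Aᵀ * A ∧
      G * (Aᵀ * A) * G = G ∧ Gᵀ = G ∧ G * (Aᵀ * A) = (Aᵀ * A) * G := by
    have hH : (Aᵀ * A).IsHermitian := by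
      simpa [Matrix.conjTranspose_eq_transpose_of_trivial] using
        Matrix.isHermitian_conjTranspose_mul_self A
    set U : Matrix n n ℝ := (hH.eigenvectorUnitary : Matrix n n ℝ) with hU
    have hUU : Uᵀ * U = 1 := by
      have := Matrix.UnitaryGroup.star_mul_self hH.eigenvectorUnitary
      simpa [Matrix.star_eq_conjTranspose, Matrix.conjTranspose_eq_transpose_of_trivial]
        using this
    set e : n → ℝ := hH.eigenvalues
    have hs : Aᵀ * A = U * Matrix.diagonal e * Uᵀ := by
      have := hH.spectral_theorem
      simpa [Unitary.conjStarAlgAut_apply, Matrix.star_eq_conjTranspose,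
        Matrix.conjTranspose_eq_transpose_of_trivial, Function.comp_def] using this
    have key : ∀ a b : n → ℝ, (U * Matrix.diagonal a * Uᵀ) * (U * Matrix.diagonal b * Uᵀ)
        = U * Matrix.diagonal (fun i => a i * b i) * Uᵀ := by
      intro a b
      calc (U * Matrix.diagonal a * Uᵀ) * (U * Matrix.diagonal b * Uᵀ)
          = U * Matrix.diagonal a * (Uᵀ * U) * Matrix.diagonal b * Uᵀ := by
            simp only [Matrix.mul_assoc]
        _ = U * Matrix.diagonal (fun i => a i * b i) * Uᵀ := by
            rw [hUU, Matrix.mul_one, Matrix.mul_assoc U, Matrix.diagonal_mul_diagonal]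
    refine ⟨U * Matrix.diagonal (fun i => (e i)⁻¹) * Uᵀ, ?_, ?_, ?_, ?_⟩
    · rw [hs, key, key]
      congr 3; ext i
      by_cases h : e i = 0 <;> simp [h]
    · rw [hs, key, key]
      congr 3; ext i
      by_cases h : e i = 0 <;> simp [h]
    · simp [Matrix.transpose_mul, Matrix.mul_assoc]
    · rw [hs, key, key]
      congr 3; ext i
      ring
  refine ⟨G * Aᵀ, ?_, ?_, ?_, ?_⟩
  · have h0 : Aᴴ * A * (G * (Aᵀ * A) - 1) = 0 := by
      rw [Matrix.conjTranspose_eq_transpose_of_trivial, Matrix.mul_sub, Matrix.mul_one,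
        ← Matrix.mul_assoc, hG1, sub_self]
    have h1 := (Matrix.conjTranspose_mul_self_mul_eq_zero A _).1 h0
    rw [Matrix.mul_sub, Matrix.mul_one, sub_eq_zero] at h1
    simpa only [Matrix.mul_assoc] using h1
  · calc G * Aᵀ * A * (G * Aᵀ) = (G * (Aᵀ * A) * G) * Aᵀ := by simp only [Matrix.mul_assoc]
      _ = G * Aᵀ := by rw [hG2]
  · simp [Matrix.transpose_mul, hG3, Matrix.mul_assoc]
  · calc (G * Aᵀ * A)ᵀ = (Aᵀ * A) * G := by simp [Matrix.transpose_mul, hG3, Matrix.mul_assoc]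
      _ = G * Aᵀ * A := by rw [← hG4, Matrix.mul_assoc]

/-- The Moore-Penrose pseudoinverse of a real matrix. -/
def pinv {m n : Type*} [Fintype m] [Fintype n] (A : Matrix m n ℝ) : Matrix n m ℝ :=
  Classical.choose (exists_isMoorePenroseInverse A)

theorem pinv_spec {m n : Type*} [Fintype m] [Fintype n] (A : Matrix m n ℝ) :
    IsMoorePenroseInverse A (pinv A) :=
  Classical.choose_spec (exists_isMoorePenroseInverse A)

/-! ### Knots, splines and B-splines in one variable

Knots are given as `lam : Fin (g + 2) → ℝ`, i.e. `a = lam 0 < ⋯ < lam (g + 1) = b`. -/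

/-- The interval `[a, b]` spanned by the knots. -/
def dom {g : ℕ} (lam : Fin (g + 2) → ℝ) : Set ℝ := Icc (lam 0) (lam (Fin.last (g + 1)))

/-- The knot sequence continued by coincident additional knots:
`⋯ = λ₋₁ = λ₀ = a` and `b = λ_{g+1} = λ_{g+2} = ⋯`. -/
def extKnot {g : ℕ} (lam : Fin (g + 2) → ℝ) (i : ℤ) : ℝ :=
  lam ⟨min i.toNat (g + 1), by omega⟩

/-- `s` is (on `[a, b]`) a polynomial spline of degree `k > 0` with the given (simple) knots:
a polynomial of degree at most `k` between consecutive knots, and of class `C^{k-1}`. -/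
def IsSpline {g : ℕ} (k : ℕ) (lam : Fin (g + 2) → ℝ) (s : ℝ → ℝ) : Prop :=
  (∀ i : Fin (g + 1), ∃ p : Polynomial ℝ, p.natDegree ≤ k ∧
    ∀ x ∈ Icc (lam i.castSucc) (lam i.succ), s x = p.eval x) ∧
  ContDiffOn ℝ ((k - 1 : ℕ) : WithTop ℕ∞) s (dom lam)

open Classical in
/-- The B-spline of degree `d` (order `d + 1`) with index `i`, supported on `[λᵢ, λ_{i+d+1}]`, by
the Cox-de Boor recursion (a quotient with zero denominator counts as `0`). The B-splines of
degree `0` are the indicators of `[λᵢ, λᵢ₊₁)`; the last nondegenerate one includes `b`. -/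
def bspline {g : ℕ} (lam : Fin (g + 2) → ℝ) : ℕ → ℤ → ℝ → ℝ
  | 0, i, x =>
      if (extKnot lam i ≤ x ∧ x < extKnot lam (i + 1)) ∨
        (extKnot lam i < extKnot lam (i + 1) ∧
          extKnot lam (i + 1) = lam (Fin.last (g + 1)) ∧ x = lam (Fin.last (g + 1)))
      then 1 else 0
  | d + 1, i, x =>
      (x - extKnot lam i) / (extKnot lam (i + d + 1) - extKnot lam i) * bspline lam d i x +
      (extKnot lam (i + d + 2) - x) / (extKnot lam (i + d + 2) - extKnot lam (i + 1)) *
        bspline lam d (i + 1) x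

/-- Collocation matrix of the B-splines of degree `k`; column `p` belongs to the index
`i = p - k`, so that `i` runs from `-k` to `g`. -/
def colloc {g : ℕ} {ι : Type*} (k : ℕ) (lam : Fin (g + 2) → ℝ) (x : ι → ℝ) :
    Matrix ι (Fin (g + k + 1)) ℝ :=
  Matrix.of fun r p => bspline lam k ((p : ℤ) - k) (x r)

/-- The bidiagonal difference matrix with `-1` on the diagonal and `1` above it. -/
def diffMat (m n : ℕ) : Matrix (Fin m) (Fin n) ℝ :=
  Matrix.of fun p q => if (q : ℕ) = p then -1 else if (q : ℕ) = p + 1 then 1 else 0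

/-- `D_j = (k + 1 - j) diag(d_{-k+j}, …, d_g)` with `dᵢ = 1 / (λ_{i+k+1-j} - λᵢ)`; row `p`
belongs to the index `i = p - k + j`. For `j = 0` this is `D_x`. -/
def scaleMat {g : ℕ} (k : ℕ) (lam : Fin (g + 2) → ℝ) (j : ℕ) :
    Matrix (Fin (g + k + 1 - j)) (Fin (g + k + 1 - j)) ℝ :=
  ((k : ℝ) + 1 - j) • Matrix.diagonal fun p : Fin (g + k + 1 - j) =>
    let i : ℤ := (p : ℤ) - k + j
    1 / (extKnot lam (i + k + 1 - j) - extKnot lam i)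

/-- `S_u = D_u L_u ⋯ D_1 L_1`, mapping the coefficients of a spline of degree `k` to
those of its `u`-th derivative. -/
def derivMat {g : ℕ} (k : ℕ) (lam : Fin (g + 2) → ℝ) :
    (u : ℕ) → Matrix (Fin (g + k + 1 - u)) (Fin (g + k + 1)) ℝ
  | 0 => (1 : Matrix (Fin (g + k + 1)) (Fin (g + k + 1)) ℝ)
  | u + 1 => scaleMat k lam (u + 1) * diffMat (g + k + 1 - (u + 1)) (g + k + 1 - u) *
      derivMat k lam u

/-- The Gram matrix `M_{k,u}` of the B-splines of order `k + 1 - u` (degree `k - u`), with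
indices `i, j = -k + u, …, g`. -/
def gramMat {g : ℕ} (k : ℕ) (lam : Fin (g + 2) → ℝ) (u : ℕ) :
    Matrix (Fin (g + k + 1 - u)) (Fin (g + k + 1 - u)) ℝ :=
  Matrix.of fun p q => ∫ x in dom lam,
    bspline lam (k - u) ((p : ℤ) - k + u) x * bspline lam (k - u) ((q : ℤ) - k + u) x

/-! ### Tensor product splines -/

/-- `s` is (on `Ω = [a, b] × [c, d]`) a tensor product spline of degree `k` in `x` and `l` in `y`:
an element of the span of the products of univariate splines. -/
def IsTensorSpline {g h : ℕ} (k l : ℕ) (lam : Fin (g + 2) → ℝ) (mu : Fin (h + 2) → ℝ)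
    (s : ℝ → ℝ → ℝ) : Prop :=
  ∃ (N : ℕ) (p q : Fin N → ℝ → ℝ), (∀ r, IsSpline k lam (p r)) ∧ (∀ r, IsSpline l mu (q r)) ∧
    ∀ x ∈ dom lam, ∀ y ∈ dom mu, s x y = ∑ r, p r x * q r y

/-- The integral of `s` over `Ω = [a, b] × [c, d]`. -/
def integralΩ {g h : ℕ} (lam : Fin (g + 2) → ℝ) (mu : Fin (h + 2) → ℝ) (s : ℝ → ℝ → ℝ) : ℝ :=
  ∫ z in dom lam ×ˢ dom mu, s z.1 z.2

/-- The derivative `∂ᵘ/∂xᵘ ∂ᵛ/∂yᵛ s` on `Ω` (one-sided at the boundary of `Ω`). -/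
def mixedDeriv {g h : ℕ} (lam : Fin (g + 2) → ℝ) (mu : Fin (h + 2) → ℝ) (u v : ℕ)
    (s : ℝ → ℝ → ℝ) : ℝ → ℝ → ℝ := fun x y =>
  iteratedDerivWithin u (fun x' => iteratedDerivWithin v (fun y' => s x' y') (dom mu) y)
    (dom lam) x

/-- The penalized least squares functional `J_{uv}`. -/
def J {g h n m : ℕ} (lam : Fin (g + 2) → ℝ) (mu : Fin (h + 2) → ℝ)
    (x : Fin n → ℝ) (y : Fin m → ℝ) (F : Matrix (Fin n) (Fin m) ℝ) (α : ℝ) (u v : ℕ)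
    (s : ℝ → ℝ → ℝ) : ℝ :=
  α * ∑ i, ∑ j, (F i j - s (x i) (y j)) ^ 2 +
    (1 - α) * integralΩ lam mu (fun x' y' => mixedDeriv lam mu u v s x' y' ^ 2)

/-- The spline `Σ bᵢⱼ Bᵢ(x) Bⱼ(y) = 𝔹(x, y) cs(B)`, where `𝔹(x, y)` is the row
`B_{l+1}(y) ⊗ B_{k+1}(x)` and `β = cs(B)` is the vectorized coefficient matrix. -/
def tensorSpline {g h : ℕ} (k l : ℕ) (lam : Fin (g + 2) → ℝ) (mu : Fin (h + 2) → ℝ)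
    (β : Fin (h + l + 1) × Fin (g + k + 1) → ℝ) (x y : ℝ) : ℝ :=
  ((colloc l mu (fun _ : Unit => y) ⊗ₖ colloc k lam (fun _ : Unit => x)) *ᵥ β) ((), ())

/-- `𝔻 = D_y ⊗ D_x`. -/
def tensorD {g h : ℕ} (k l : ℕ) (lam : Fin (g + 2) → ℝ) (mu : Fin (h + 2) → ℝ) :
    Matrix (Fin (h + l + 1) × Fin (g + k + 1)) (Fin (h + l + 1) × Fin (g + k + 1)) ℝ :=
  (scaleMat l mu 0 : Matrix (Fin (h + l + 1)) (Fin (h + l + 1)) ℝ) ⊗ₖ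
    (scaleMat k lam 0 : Matrix (Fin (g + k + 1)) (Fin (g + k + 1)) ℝ)

/-- `𝕂 = K_y ⊗ K_x`. -/
def tensorK (k l g h : ℕ) :
    Matrix (Fin (h + l + 1) × Fin (g + k + 1)) (Fin (h + l + 2) × Fin (g + k + 2)) ℝ :=
  diffMat (h + l + 1) (h + l + 2) ⊗ₖ diffMat (g + k + 1) (g + k + 2)

/-- Indices of `cs(C̃)`: those of `cs(C)` without the first one, i.e. without that of
`c_{-k-1,-l-1}`. (A pair consists of the column index and the row index of `C`.) -/
abbrev RedIdx (k l g h : ℕ) : Type :=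
  {r : Fin (h + l + 2) × Fin (g + k + 2) // r ≠ (0, 0)}

/-- The matrix with `cs(C) = elimMat cs(C̃)` whenever
`c_{-k-1,-l-1} = c_{-k-1,h} + c_{g,-l-1} - c_{g,h}`. -/
def elimMat (k l g h : ℕ) : Matrix (Fin (h + l + 2) × Fin (g + k + 2)) (RedIdx k l g h) ℝ :=
  Matrix.of fun r s =>
    if r = (0, 0) then
      (if s.1 = (Fin.last _, 0) then 1 else 0) + (if s.1 = (0, Fin.last _) then 1 else 0) -
        (if s.1 = (Fin.last _, Fin.last _) then 1 else 0)
    else if r = s.1 then 1 else 0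

/-- `K̃`, obtained from `𝕂` by eliminating the coefficient `c_{-k-1,-l-1}`. -/
def redK (k l g h : ℕ) : Matrix (Fin (h + l + 1) × Fin (g + k + 1)) (RedIdx k l g h) ℝ :=
  tensorK k l g h * elimMat k l g h

/-- `𝔹 = B_{l+1}(y) ⊗ B_{k+1}(x)`, the collocation matrix at the data points. -/
def tensorB {g h n m : ℕ} (k l : ℕ) (lam : Fin (g + 2) → ℝ) (mu : Fin (h + 2) → ℝ)
    (x : Fin n → ℝ) (y : Fin m → ℝ) :
    Matrix (Fin m × Fin n) (Fin (h + l + 1) × Fin (g + k + 1)) ℝ :=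
  colloc l mu y ⊗ₖ colloc k lam x

/-- `𝕊 = S_v ⊗ S_u`. -/
def tensorS {g h : ℕ} (k l : ℕ) (lam : Fin (g + 2) → ℝ) (mu : Fin (h + 2) → ℝ) (u v : ℕ) :
    Matrix (Fin (h + l + 1 - v) × Fin (g + k + 1 - u)) (Fin (h + l + 1) × Fin (g + k + 1)) ℝ :=
  derivMat l mu v ⊗ₖ derivMat k lam u

/-- `𝕄 = M_{l,v} ⊗ M_{k,u}`. -/
def tensorM {g h : ℕ} (k l : ℕ) (lam : Fin (g + 2) → ℝ) (mu : Fin (h + 2) → ℝ) (u v : ℕ) :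
    Matrix (Fin (h + l + 1 - v) × Fin (g + k + 1 - u))
      (Fin (h + l + 1 - v) × Fin (g + k + 1 - u)) ℝ :=
  gramMat l mu v ⊗ₖ gramMat k lam u

/-- `cs(C̃*) = [K̃ᵀ 𝔻ᵀ [(1-α) 𝕊ᵀ 𝕄 𝕊 + α 𝔹ᵀ 𝔹] 𝔻 K̃]⁺ α K̃ᵀ 𝔻ᵀ 𝔹ᵀ cs(F)`. -/
def optCoeff {g h n m : ℕ} (k l : ℕ) (lam : Fin (g + 2) → ℝ) (mu : Fin (h + 2) → ℝ)
    (x : Fin n → ℝ) (y : Fin m → ℝ) (F : Matrix (Fin n) (Fin m) ℝ) (α : ℝ) (u v : ℕ) :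
    RedIdx k l g h → ℝ :=
  pinv ((redK k l g h)ᵀ * (tensorD k l lam mu)ᵀ *
      ((1 - α) • ((tensorS k l lam mu u v)ᵀ * tensorM k l lam mu u v * tensorS k l lam mu u v) +
        α • ((tensorB k l lam mu x y)ᵀ * tensorB k l lam mu x y)) *
      tensorD k l lam mu * redK k l g h) *ᵥ
    (α • ((redK k l g h)ᵀ * (tensorD k l lam mu)ᵀ * (tensorB k l lam mu x y)ᵀ) *ᵥ F.vec)

end TensorSpline

end

open TensorSpline

noncomputable section

namespace TensorSpline

/-! ### The extended knot sequence -/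

section Knots

variable {g : ℕ} {lam : Fin (g + 2) → ℝ}

theorem extKnot_monotone (hlam : StrictMono lam) : Monotone (extKnot lam) := by
  intro i j hij
  refine hlam.monotone ?_
  simp only [Fin.le_def]
  omega

theorem extKnot_of_nonpos (i : ℤ) (hi : i ≤ 0) : extKnot lam i = lam 0 := by
  unfold extKnot
  congr 1
  ext
  simp
  omega

theorem extKnot_of_ge (i : ℤ) (hi : (g : ℤ) + 1 ≤ i) :
    extKnot lam i = lam (Fin.last (g + 1)) := by
  unfold extKnot
  congr 1
  ext
  simp
  omega

theorem extKnot_lt (hlam : StrictMono lam) {i j : ℤ} (hij : i < j) (hj : 0 < j)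
    (hi : i ≤ g) : extKnot lam i < extKnot lam j := by
  refine hlam ?_
  simp only [Fin.lt_def]
  omega

theorem extKnot_castSucc (i : Fin (g + 1)) : extKnot lam (i : ℤ) = lam i.castSucc := by
  unfold extKnot
  congr 1
  ext
  simp

theorem extKnot_succ (i : Fin (g + 1)) : extKnot lam ((i : ℤ) + 1) = lam i.succ := by
  unfold extKnot
  congr 1
  ext
  simp
  omega

theorem extKnot_mem_dom (hlam : StrictMono lam) (i : ℤ) : extKnot lam i ∈ dom lam :=
  ⟨hlam.monotone (Fin.zero_le _), hlam.monotone (Fin.le_last _)⟩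

theorem lam_zero_lt_last (hlam : StrictMono lam) : lam 0 < lam (Fin.last (g + 1)) :=
  hlam Fin.last_pos

theorem exists_extKnot_le_lt {x : ℝ} (hx : lam 0 ≤ x) (n : ℕ) (hn : x < extKnot lam n) :
    ∃ m < n, extKnot lam m ≤ x ∧ x < extKnot lam (m + 1) := by
  induction n with
  | zero =>
    rw [extKnot_of_nonpos _ (by simp)] at hn
    exact absurd hn (not_lt.2 hx)
  | succ n ih =>
    rcases lt_or_ge x (extKnot lam n) with h | h
    · obtain ⟨m, hm, h1⟩ := ih h
      exact ⟨m, by omega, h1⟩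
    · exact ⟨n, by omega, h, by simpa using hn⟩

theorem exists_knot_interval (hlam : StrictMono lam) {x : ℝ} (hx : x ∈ dom lam) :
    ∃ m : ℕ, m ≤ g ∧ extKnot lam m ≤ x ∧
      (x < extKnot lam (m + 1) ∨ (m = g ∧ x = lam (Fin.last (g + 1)))) := by
  rcases hx.2.lt_or_eq with h | h
  · obtain ⟨m, hm, h1, h2⟩ := exists_extKnot_le_lt hx.1 (g + 1)
      (by rwa [extKnot_of_ge _ (by simp)])
    exact ⟨m, by omega, h1, Or.inl h2⟩
  · exact ⟨g, le_rfl, by rw [h]; exact (extKnot_mem_dom hlam _).2, Or.inr ⟨rfl, h⟩⟩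

theorem exists_mem_Icc_extKnot (hlam : StrictMono lam) {x : ℝ} (hx : x ∈ dom lam) :
    ∃ m : Fin (g + 1), x ∈ Icc (extKnot lam (m : ℤ)) (extKnot lam ((m : ℤ) + 1)) := by
  obtain ⟨m, hm, h1, h2⟩ := exists_knot_interval hlam hx
  refine ⟨⟨m, by omega⟩, h1, ?_⟩
  rcases h2 with h2 | ⟨rfl, h2⟩
  · exact h2.le
  · rw [h2, extKnot_of_ge _ le_rfl]

theorem Icc_extKnot_subset_dom (hlam : StrictMono lam) (m : ℤ) :
    Icc (extKnot lam m) (extKnot lam (m + 1)) ⊆ dom lam :=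
  Icc_subset_Icc (extKnot_mem_dom hlam _).1 (extKnot_mem_dom hlam _).2

theorem dom_eq_iUnion (hlam : StrictMono lam) :
    dom lam = ⋃ m : Fin (g + 1), Icc (extKnot lam (m : ℤ)) (extKnot lam ((m : ℤ) + 1)) := by
  ext x
  rw [mem_iUnion]
  exact ⟨fun hx => exists_mem_Icc_extKnot hlam hx,
    fun ⟨m, hm⟩ => Icc_extKnot_subset_dom hlam _ hm⟩

theorem uniqueDiffOn_dom (hlam : StrictMono lam) : UniqueDiffOn ℝ (dom lam) :=
  uniqueDiffOn_Icc (lam_zero_lt_last hlam)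

/-- A function that agrees on each knot interval with a differentiable function is differentiable
if the derivatives of the pieces fit together. -/
theorem hasDerivWithinAt_dom_of_pieces (hlam : StrictMono lam) {f f' : ℝ → ℝ}
    {P P' : Fin (g + 1) → ℝ → ℝ} (hP : ∀ m x, HasDerivAt (P m) (P' m x) x)
    (hf : ∀ m : Fin (g + 1), ∀ x ∈ Icc (extKnot lam (m : ℤ)) (extKnot lam ((m : ℤ) + 1)),
      f x = P m x)
    (hf' : ∀ m : Fin (g + 1), ∀ x ∈ Icc (extKnot lam (m : ℤ)) (extKnot lam ((m : ℤ) + 1)),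
      f' x = P' m x)
    (x : ℝ) : HasDerivWithinAt f (f' x) (dom lam) x := by
  rw [dom_eq_iUnion hlam, hasDerivWithinAt_iff_tendsto, nhdsWithin_iUnion, Filter.tendsto_iSup]
  intro m
  rw [← hasDerivWithinAt_iff_tendsto]
  by_cases hx : x ∈ Icc (extKnot lam (m : ℤ)) (extKnot lam ((m : ℤ) + 1))
  · rw [hf' m x hx]
    exact (hP m x).hasDerivWithinAt.congr (hf m) (hf m x hx)
  · exact HasFDerivWithinAt.of_notMem_closure (by rwa [isClosed_Icc.closure_eq])

theorem continuousOn_dom_of_pieces (hlam : StrictMono lam) {f : ℝ → ℝ}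
    {P : Fin (g + 1) → ℝ → ℝ} (hP : ∀ m, Continuous (P m))
    (hf : ∀ m : Fin (g + 1), ∀ x ∈ Icc (extKnot lam (m : ℤ)) (extKnot lam ((m : ℤ) + 1)),
      f x = P m x) : ContinuousOn f (dom lam) := by
  rw [dom_eq_iUnion hlam]
  refine (locallyFinite_of_finite _).continuousOn_iUnion (fun _ => isClosed_Icc) fun m => ?_
  exact (hP m).continuousOn.congr (hf m)

end Knots

/-! ### The polynomial pieces of the B-splines -/

open Polynomial in
/-- The polynomial with which the B-spline of degree `d` with index `i` agrees between the knots
`t m` and `t (m + 1)`. -/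
def bpoly (t : ℤ → ℝ) (m : ℤ) : ℕ → ℤ → Polynomial ℝ
  | 0, i => if i = m then 1 else 0
  | d + 1, i =>
      C (t (i + d + 1) - t i)⁻¹ * (X - C (t i)) * bpoly t m d i +
      C (t (i + d + 2) - t (i + 1))⁻¹ * (C (t (i + d + 2)) - X) * bpoly t m d (i + 1)

theorem bpoly_eval_succ (t : ℤ → ℝ) (m : ℤ) (d : ℕ) (i : ℤ) (x : ℝ) :
    (bpoly t m (d + 1) i).eval x =
      (x - t i) / (t (i + d + 1) - t i) * (bpoly t m d i).eval x +
      (t (i + d + 2) - x) / (t (i + d + 2) - t (i + 1)) * (bpoly t m d (i + 1)).eval x := by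
  simp [bpoly]
  ring

theorem bpoly_natDegree_le (t : ℤ → ℝ) (m : ℤ) (d : ℕ) (i : ℤ) :
    (bpoly t m d i).natDegree ≤ d := by
  induction d generalizing i with
  | zero => unfold bpoly; split_ifs <;> simp
  | succ d ih =>
    have h1 (a b : ℝ) : (Polynomial.C a * (Polynomial.X - Polynomial.C b)).natDegree ≤ 1 := by
      compute_degree
    have h2 (a b : ℝ) : (Polynomial.C a * (Polynomial.C b - Polynomial.X)).natDegree ≤ 1 := by
      compute_degree
    unfold bpoly
    refine (Polynomial.natDegree_add_le _ _).trans (max_le ?_ ?_)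
    · refine Polynomial.natDegree_mul_le.trans ?_
      have := h1 (t (i + d + 1) - t i)⁻¹ (t i)
      have := ih i
      omega
    · refine Polynomial.natDegree_mul_le.trans ?_
      have := h2 (t (i + d + 2) - t (i + 1))⁻¹ (t (i + d + 2))
      have := ih (i + 1)
      omega

/-- The derivative formula for B-splines, on one knot interval. -/
theorem bpoly_derivative_eval {t : ℤ → ℝ} (ht : Monotone t) (m : ℤ) (d : ℕ) (i : ℤ) (x : ℝ) :
    (bpoly t m (d + 1) i).derivative.eval x =
      (d + 1) * ((bpoly t m d i).eval x / (t (i + d + 1) - t i) -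
        (bpoly t m d (i + 1)).eval x / (t (i + d + 2) - t (i + 1))) := by
  induction d generalizing i with
  | zero =>
    simp only [bpoly]
    split_ifs <;> simp <;> ring
  | succ d ih =>
    have e1 : i + 1 + (d : ℤ) + 1 = i + d + 2 := by ring
    have e2 : i + 1 + (d : ℤ) + 2 = i + d + 3 := by ring
    have e3 : i + ((d + 1 : ℕ) : ℤ) + 1 = i + d + 2 := by push_cast; ring
    have e4 : i + ((d + 1 : ℕ) : ℤ) + 2 = i + d + 3 := by push_cast; ring
    have e5 : i + 1 + 1 = i + 2 := by ring
    have hL : (bpoly t m (d + 2) i).derivative.eval x =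
        (bpoly t m (d + 1) i).eval x / (t (i + d + 2) - t i) -
        (bpoly t m (d + 1) (i + 1)).eval x / (t (i + d + 3) - t (i + 1)) +
        (x - t i) / (t (i + d + 2) - t i) * (bpoly t m (d + 1) i).derivative.eval x +
        (t (i + d + 3) - x) / (t (i + d + 3) - t (i + 1)) *
          (bpoly t m (d + 1) (i + 1)).derivative.eval x := by
      rw [bpoly]
      simp only [Polynomial.derivative_add, Polynomial.derivative_mul, Polynomial.derivative_C,
        Polynomial.derivative_X, Polynomial.derivative_sub, Polynomial.eval_add,
        Polynomial.eval_mul, Polynomial.eval_sub, Polynomial.eval_C, Polynomial.eval_X,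
        Polynomial.eval_zero, Polynomial.eval_one, e3, e4]
      ring
    rw [hL, ih, ih, e1, e2, e3, e4, e5, bpoly_eval_succ, bpoly_eval_succ, e1, e2, e5]
    push_cast
    have hd : t (i + d + 2) = t (i + 1) ∨
        (t (i + d + 2) - t i ≠ 0 ∧ t (i + d + 3) - t (i + 1) ≠ 0) := by
      rcases (ht (show i + 1 ≤ i + d + 2 by omega)).eq_or_lt with h | h
      · exact Or.inl h.symm
      · have h1 := ht (show i ≤ i + 1 by omega)
        have h2 := ht (show i + d + 2 ≤ i + d + 3 by omega)
        exact Or.inr ⟨by linarith, by linarith⟩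
    set A := (bpoly t m d i).eval x / (t (i + d + 1) - t i) with hA
    set B := (bpoly t m d (i + 1)).eval x / (t (i + d + 2) - t (i + 1)) with hB
    set C := (bpoly t m d (i + 2)).eval x / (t (i + d + 3) - t (i + 2)) with hC
    have k1 : (x - t i) / (t (i + d + 1) - t i) * (bpoly t m d i).eval x = (x - t i) * A := by
      rw [hA]; ring
    have k2 : (t (i + d + 2) - x) / (t (i + d + 2) - t (i + 1)) * (bpoly t m d (i + 1)).eval x
        = (t (i + d + 2) - x) * B := by rw [hB]; ring
    have k3 : (x - t (i + 1)) / (t (i + d + 2) - t (i + 1)) * (bpoly t m d (i + 1)).eval x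
        = (x - t (i + 1)) * B := by rw [hB]; ring
    have k4 : (t (i + d + 3) - x) / (t (i + d + 3) - t (i + 2)) * (bpoly t m d (i + 2)).eval x
        = (t (i + d + 3) - x) * C := by rw [hC]; ring
    rw [k1, k2, k3, k4]
    rcases hd with h | ⟨h1, h2⟩
    · have : B = 0 := by rw [hB, h]; simp
      rw [this]
      ring
    · field_simp
      ring

section BSpline

variable {g : ℕ} {lam : Fin (g + 2) → ℝ}

theorem bpoly_eval_last (hlam : StrictMono lam) (d : ℕ) (i : ℤ) :
    (bpoly (extKnot lam) g d i).eval (lam (Fin.last (g + 1))) = if i = g then 1 else 0 := by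
  induction d generalizing i with
  | zero => unfold bpoly; split_ifs <;> simp
  | succ d ih =>
    rw [bpoly_eval_succ, ih, ih]
    have h2 : (extKnot lam (i + d + 2) - lam (Fin.last (g + 1))) /
        (extKnot lam (i + d + 2) - extKnot lam (i + 1)) * (if i + 1 = (g : ℤ) then 1 else 0)
        = 0 := by
      split_ifs with h
      · rw [extKnot_of_ge (i + d + 2) (by omega)]; simp
      · simp
    rw [h2]
    split_ifs with h
    · subst h
      have := extKnot_lt hlam (show (g : ℤ) < g + d + 1 by omega) (by omega) le_rfl
      rw [← extKnot_of_ge (lam := lam) (g + d + 1) (by omega)]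
      rw [div_self (by linarith)]
      simp
    · simp

theorem bpoly_eval_zero (hlam : StrictMono lam) (d : ℕ) (i : ℤ) :
    (bpoly (extKnot lam) 0 d i).eval (lam 0) = if i = -d then 1 else 0 := by
  induction d generalizing i with
  | zero => unfold bpoly; split_ifs <;> simp_all
  | succ d ih =>
    rw [bpoly_eval_succ, ih, ih]
    have h2 : (lam 0 - extKnot lam i) /
        (extKnot lam (i + d + 1) - extKnot lam i) * (if i = -(d : ℤ) then 1 else 0)
        = 0 := by
      split_ifs with h
      · rw [extKnot_of_nonpos i (by omega)]; simp
      · simp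
    rw [h2]
    by_cases h : i + 1 = -(d : ℤ)
    · rw [if_pos h, if_pos (by push_cast; omega)]
      have := extKnot_lt hlam (show i + 1 < i + d + 2 by omega) (by omega) (by omega)
      rw [← extKnot_of_nonpos (lam := lam) (i + 1) (by omega)]
      rw [div_self (by linarith)]
      simp
    · rw [if_neg h, if_neg (by push_cast; omega)]
      simp

/-- B-spline pieces of positive degree fit together continuously at the inner knots. -/
theorem bpoly_eval_knot (hlam : StrictMono lam) (d : ℕ) (i : ℤ) (m : ℕ) (hm : m < g) :
    (bpoly (extKnot lam) m (d + 1) i).eval (extKnot lam (m + 1)) =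
      (bpoly (extKnot lam) (m + 1) (d + 1) i).eval (extKnot lam (m + 1)) := by
  induction d generalizing i with
  | zero =>
    rw [bpoly_eval_succ, bpoly_eval_succ]
    have h1 := extKnot_lt hlam (show (m : ℤ) < m + 1 by omega) (by omega) (by omega)
    have h2 := extKnot_lt hlam (show (m : ℤ) + 1 < m + 2 by omega) (by omega) (by omega)
    simp only [bpoly]
    rcases lt_trichotomy i m with h | h | h
    · rw [if_neg (show ¬i = (m : ℤ) by omega), if_neg (show ¬i = (m : ℤ) + 1 by omega),
        if_neg (show ¬i + 1 = (m : ℤ) + 1 by omega)]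
      split_ifs with h3
      · rw [show i + ((0 : ℕ) : ℤ) + 2 = m + 1 by push_cast; omega]
        simp
      · rfl
    · subst h
      rw [if_pos rfl, if_neg (by omega), if_neg (by omega), if_pos rfl]
      have e : (m : ℤ) + ((0 : ℕ) : ℤ) + 1 = m + 1 := by push_cast; omega
      have e' : (m : ℤ) + ((0 : ℕ) : ℤ) + 2 = m + 2 := by push_cast; omega
      rw [e, e', div_self (by linarith), div_self (by linarith)]
      simp
    · rw [if_neg (show ¬i = (m : ℤ) by omega), if_neg (show ¬i + 1 = (m : ℤ) by omega),
        if_neg (show ¬i + 1 = (m : ℤ) + 1 by omega)]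
      split_ifs with h3
      · rw [h3]
        simp
      · rfl
  | succ d ih =>
    rw [bpoly_eval_succ _ _ (d + 1), bpoly_eval_succ _ _ (d + 1), ih, ih]

theorem bspline_eq_bpoly_of_lt (hlam : StrictMono lam) (d : ℕ) (i : ℤ) (m : ℕ) (hm : m ≤ g)
    {x : ℝ} (h1 : extKnot lam m ≤ x)
    (h2 : x < extKnot lam (m + 1) ∨ (m = g ∧ x = lam (Fin.last (g + 1)))) :
    bspline lam d i x = (bpoly (extKnot lam) m d i).eval x := by
  induction d generalizing i with
  | zero =>
    have hmono := extKnot_monotone hlam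
    have hle : ∀ j, extKnot lam j ≤ lam (Fin.last (g + 1)) := fun j =>
      (extKnot_mem_dom hlam j).2
    simp only [bspline, bpoly]
    rcases lt_trichotomy i m with h | h | h
    · have h3 := hmono (show i + 1 ≤ m by omega)
      have h4 := extKnot_lt hlam (show (m : ℤ) < m + 1 by omega) (by omega) (by omega)
      have h5 := hle (m + 1)
      rw [if_neg, if_neg (by omega)]
      · simp
      · rintro (⟨-, h6⟩ | ⟨-, h6, -⟩) <;> linarith
    · subst h
      rw [if_pos, if_pos rfl]
      · simp
      · rcases h2 with h2 | ⟨rfl, h2⟩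
        · exact Or.inl ⟨h1, h2⟩
        · exact Or.inr ⟨extKnot_lt hlam (by omega) (by omega) (by omega),
            extKnot_of_ge _ (by omega), h2⟩
    · have h3 := hmono (show (m : ℤ) + 1 ≤ i by omega)
      have h4 := hle (i + 1)
      have h5 := hle i
      rw [if_neg, if_neg (by omega)]
      · simp
      · rcases h2 with h2 | ⟨rfl, h2⟩
        · rintro (⟨h6, -⟩ | ⟨h6, h7, h8⟩) <;> linarith
        · rw [extKnot_of_ge (i + 1) (by omega), extKnot_of_ge i (by omega)]
          rintro (⟨-, h6⟩ | ⟨h6, -, -⟩) <;> linarith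
  | succ d ih => rw [bspline, bpoly_eval_succ, ih, ih]

theorem bspline_succ_eq_bpoly (hlam : StrictMono lam) (d : ℕ) (i : ℤ) (m : Fin (g + 1))
    {x : ℝ} (hx : x ∈ Icc (extKnot lam (m : ℤ)) (extKnot lam ((m : ℤ) + 1))) :
    bspline lam (d + 1) i x = (bpoly (extKnot lam) m (d + 1) i).eval x := by
  rcases hx.2.lt_or_eq with h | h
  · exact bspline_eq_bpoly_of_lt hlam _ i m (by omega) hx.1 (Or.inl h)
  · rcases (show (m : ℕ) ≤ g by omega).lt_or_eq with hm | hm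
    · have := bspline_eq_bpoly_of_lt hlam (d + 1) i (m + 1) (by omega) (x := x)
        (by push_cast; exact h.ge)
        (Or.inl (by
          rw [h]; push_cast
          exact extKnot_lt hlam (by omega) (by omega) (by omega)))
      rw [this, h]
      push_cast
      exact (bpoly_eval_knot hlam d i m hm).symm
    · exact bspline_eq_bpoly_of_lt hlam _ i m (by omega) hx.1
        (Or.inr ⟨hm, by rw [h, extKnot_of_ge _ (by omega)]⟩)

theorem bspline_last (hlam : StrictMono lam) (d : ℕ) (i : ℤ) :
    bspline lam d i (lam (Fin.last (g + 1))) = if i = g then 1 else 0 := by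
  rw [bspline_eq_bpoly_of_lt hlam d i g le_rfl (extKnot_mem_dom hlam _).2 (Or.inr ⟨rfl, rfl⟩),
    bpoly_eval_last hlam]

theorem bspline_zero (hlam : StrictMono lam) (d : ℕ) (i : ℤ) :
    bspline lam d i (lam 0) = if i = -d then 1 else 0 := by
  have h0 : extKnot lam ((0 : ℕ) : ℤ) = lam 0 := extKnot_of_nonpos _ (by simp)
  rw [bspline_eq_bpoly_of_lt hlam d i 0 (by omega) h0.le (Or.inl (by
    rw [← h0]; exact extKnot_lt hlam (by simp) (by simp) (by simp))), Nat.cast_zero,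
    bpoly_eval_zero hlam]

theorem bspline_hasDerivWithinAt (hlam : StrictMono lam) (d : ℕ) (i : ℤ) (x : ℝ) :
    HasDerivWithinAt (bspline lam (d + 2) i)
      ((d + 2) * (bspline lam (d + 1) i x / (extKnot lam (i + d + 2) - extKnot lam i) -
        bspline lam (d + 1) (i + 1) x / (extKnot lam (i + d + 3) - extKnot lam (i + 1))))
      (dom lam) x := by
  refine hasDerivWithinAt_dom_of_pieces (f' := fun x => (d + 2) * (bspline lam (d + 1) i x /
      (extKnot lam (i + d + 2) - extKnot lam i) -
        bspline lam (d + 1) (i + 1) x / (extKnot lam (i + d + 3) - extKnot lam (i + 1)))) hlam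
    (fun m x => (bpoly (extKnot lam) m (d + 2) i).hasDerivAt x)
    (fun m x hx => bspline_succ_eq_bpoly hlam _ _ m hx) (fun m x hx => ?_) x
  have h := bpoly_derivative_eval (extKnot_monotone hlam) m (d + 1) i x
  rw [h, bspline_succ_eq_bpoly hlam _ _ m hx, bspline_succ_eq_bpoly hlam _ _ m hx]
  have e3 : i + ((d + 1 : ℕ) : ℤ) + 1 = i + d + 2 := by push_cast; ring
  have e4 : i + ((d + 1 : ℕ) : ℤ) + 2 = i + d + 3 := by push_cast; ring
  rw [e3, e4]
  push_cast
  ring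

theorem bspline_continuousOn (hlam : StrictMono lam) (d : ℕ) (i : ℤ) :
    ContinuousOn (bspline lam (d + 1) i) (dom lam) :=
  continuousOn_dom_of_pieces hlam (fun m => (bpoly (extKnot lam) m (d + 1) i).continuous)
    (fun m _ hx => bspline_succ_eq_bpoly hlam _ _ m hx)

theorem bspline_contDiffOn (hlam : StrictMono lam) (d : ℕ) (i : ℤ) :
    ContDiffOn ℝ d (bspline lam (d + 1) i) (dom lam) := by
  induction d generalizing i with
  | zero => simpa using bspline_continuousOn hlam 0 i
  | succ d ih =>
    push_cast
    rw [contDiffOn_succ_iff_derivWithin (uniqueDiffOn_dom hlam)]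
    refine ⟨fun x _ => (bspline_hasDerivWithinAt hlam d i x).differentiableWithinAt,
      by simp, ?_⟩
    refine ContDiffOn.congr ?_ fun x hx => (bspline_hasDerivWithinAt hlam d i x).derivWithin
      (uniqueDiffOn_dom hlam x hx)
    exact contDiffOn_const.mul (((ih i).div_const _).sub ((ih (i + 1)).div_const _))

theorem isSpline_bspline (hlam : StrictMono lam) {k : ℕ} (hk : 0 < k) (i : ℤ) :
    IsSpline k lam (bspline lam k i) := by
  obtain ⟨d, rfl⟩ := Nat.exists_eq_succ_of_ne_zero hk.ne'
  refine ⟨fun m => ⟨bpoly (extKnot lam) m (d + 1) i, bpoly_natDegree_le _ _ _ _,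
    fun x hx => ?_⟩, bspline_contDiffOn hlam d i⟩
  rw [← extKnot_castSucc (lam := lam), ← extKnot_succ (lam := lam)] at hx
  exact bspline_succ_eq_bpoly hlam _ _ m hx

end BSpline

section Univariate

variable {g : ℕ} {lam : Fin (g + 2) → ℝ}

/-- Summation by parts for a sequence vanishing at both ends. -/
theorem sum_mul_sub_succ {N : ℕ} (c : Fin (N + 1) → ℝ) (a : ℕ → ℝ) (h0 : a 0 = 0)
    (hN : a (N + 1) = 0) :
    ∑ p, c p * (a p - a (p + 1)) = ∑ p : Fin N, (c p.succ - c p.castSucc) * a (p + 1) := by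
  simp only [mul_sub, sub_mul, Finset.sum_sub_distrib]
  rw [Fin.sum_univ_succ, Fin.sum_univ_castSucc (fun p : Fin (N + 1) => c p * a (p + 1))]
  simp [h0, hN]

theorem sum_bspline_hasDerivWithinAt (hlam : StrictMono lam) (d : ℕ) (c : Fin (g + d + 3) → ℝ)
    (x : ℝ) :
    HasDerivWithinAt (fun x => ∑ p, c p * bspline lam (d + 2) ((p : ℤ) - (d + 2 : ℕ)) x)
      (∑ p : Fin (g + d + 2), ((d + 2 : ℝ) / (extKnot lam (p + 1) - extKnot lam (p - (d + 1))) *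
        (c p.succ - c p.castSucc)) * bspline lam (d + 1) ((p : ℤ) - (d + 1 : ℕ)) x)
      (dom lam) x := by
  have h := HasDerivWithinAt.fun_sum (u := Finset.univ) fun (p : Fin (g + d + 3)) _ =>
    (bspline_hasDerivWithinAt hlam d ((p : ℤ) - (d + 2 : ℕ)) x).const_mul (c p)
  refine h.congr_deriv ?_
  set a : ℕ → ℝ := fun q => (d + 2) * (bspline lam (d + 1) ((q : ℤ) - (d + 2)) x /
    (extKnot lam q - extKnot lam (q - (d + 2)))) with ha
  have e := sum_mul_sub_succ c a
    (by simp only [ha]; rw [extKnot_of_nonpos _ (by simp), extKnot_of_nonpos _ (by omega)]; simp)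
    (by simp only [ha]; rw [extKnot_of_ge _ (by omega), extKnot_of_ge _ (by omega)]; simp)
  refine Eq.trans ?_ (e.trans ?_)
  · refine Finset.sum_congr rfl fun p _ => ?_
    simp only [ha]
    have e1 : (p : ℤ) - (d + 2 : ℕ) + d + 2 = p := by push_cast; ring
    have e2 : (p : ℤ) - (d + 2 : ℕ) + d + 3 = (p + 1 : ℕ) := by push_cast; ring
    have e3 : (p : ℤ) - (d + 2 : ℕ) + 1 = (p + 1 : ℕ) - (d + 2) := by push_cast; ring
    have e4 : (p : ℤ) - (d + 2 : ℕ) = p - (d + 2) := by push_cast; ring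
    rw [e1, e2, e3, e4]
    ring
  · refine Finset.sum_congr rfl fun p _ => ?_
    simp only [ha]
    have e1 : ((p + 1 : ℕ) : ℤ) - (d + 2) = p - (d + 1) := by push_cast; ring
    rw [e1]
    push_cast
    ring

theorem bspline_integrableOn (hlam : StrictMono lam) (d : ℕ) (i : ℤ) :
    IntegrableOn (bspline lam (d + 1) i) (dom lam) :=
  (bspline_continuousOn hlam d i).integrableOn_compact isCompact_Icc

theorem integral_bspline_sub (hlam : StrictMono lam) (d : ℕ) (i : ℤ) :
    (d + 2) * ((∫ x in dom lam, bspline lam (d + 1) i x) /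
        (extKnot lam (i + d + 2) - extKnot lam i) -
      (∫ x in dom lam, bspline lam (d + 1) (i + 1) x) /
        (extKnot lam (i + d + 3) - extKnot lam (i + 1))) =
    (if i = g then 1 else 0) - (if i = -((d + 2 : ℕ) : ℤ) then 1 else 0) := by
  rw [← bspline_last hlam, ← bspline_zero hlam]
  have hab := (lam_zero_lt_last hlam).le
  have hc : ContinuousOn (fun x => (d + 2) * (bspline lam (d + 1) i x /
        (extKnot lam (i + d + 2) - extKnot lam i) - bspline lam (d + 1) (i + 1) x /
          (extKnot lam (i + d + 3) - extKnot lam (i + 1)))) (dom lam) :=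
    continuousOn_const.mul (((bspline_continuousOn hlam d i).div_const _).sub
      ((bspline_continuousOn hlam d (i + 1)).div_const _))
  rw [← intervalIntegral.integral_eq_sub_of_hasDerivAt_of_le hab
    (bspline_continuousOn hlam (d + 1) i)
    (fun x hx => (bspline_hasDerivWithinAt hlam d i x).hasDerivAt (Icc_mem_nhds hx.1 hx.2))
    (hc.intervalIntegrable_of_Icc hab),
    intervalIntegral.integral_of_le hab, ← integral_Icc_eq_integral_Ioc]
  change _ = ∫ x in dom lam, _
  rw [integral_const_mul, integral_sub, integral_div, integral_div]
  · exact (bspline_integrableOn hlam d i).div_const _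
  · exact (bspline_integrableOn hlam d (i + 1)).div_const _

theorem integral_bspline (hlam : StrictMono lam) {k : ℕ} (hk : 0 < k) (i : ℤ) (h1 : -(k : ℤ) ≤ i)
    (h2 : i ≤ g) : ∫ x in dom lam, bspline lam k i x =
      (extKnot lam (i + k + 1) - extKnot lam i) / (k + 1) := by
  obtain ⟨d, rfl⟩ := Nat.exists_eq_succ_of_ne_zero hk.ne'
  rw [Nat.succ_eq_add_one] at *
  have key : ∀ n : ℕ, n ≤ g + d + 1 →
      (d + 2) * ((∫ x in dom lam, bspline lam (d + 1) (g - n) x) /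
        (extKnot lam ((g : ℤ) - n + d + 2) - extKnot lam (g - n))) = 1 := by
    intro n hn
    induction n with
    | zero =>
      have h := integral_bspline_sub hlam d g
      rw [if_pos rfl, if_neg (by omega), extKnot_of_ge (g + d + 3) (by omega),
        extKnot_of_ge (g + 1) (by omega)] at h
      simpa using h
    | succ n ih =>
      have h := integral_bspline_sub hlam d (g - (n + 1 : ℕ))
      rw [if_neg (by omega), if_neg (by omega), mul_sub] at h
      have e1 : (g : ℤ) - (n + 1 : ℕ) + 1 = g - n := by push_cast; ring
      have e2 : (g : ℤ) - (n + 1 : ℕ) + d + 3 = g - n + d + 2 := by push_cast; ring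
      rw [e1, e2, ih (by omega)] at h
      linarith
  have h := key (g - i).toNat (by omega)
  have e1 : (g : ℤ) - (g - i).toNat = i := by omega
  have e2 : i + (d + 1 : ℕ) + 1 = i + d + 2 := by push_cast; ring
  rw [e1] at h
  rw [e2]
  have hpos := extKnot_lt hlam (show i < i + d + 2 by omega) (by omega) h2
  have h3 : extKnot lam (i + d + 2) - extKnot lam i ≠ 0 := by linarith
  push_cast
  field_simp at h ⊢
  linarith

theorem IsSpline.derivWithin (hlam : StrictMono lam) {k : ℕ} {s : ℝ → ℝ}
    (hs : IsSpline (k + 2) lam s) : IsSpline (k + 1) lam (derivWithin s (dom lam)) := by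
  have hc : ContDiffOn ℝ ((k : WithTop ℕ∞) + 1) s (dom lam) := by
    have := hs.2
    simpa using this
  rw [contDiffOn_succ_iff_derivWithin (uniqueDiffOn_dom hlam)] at hc
  refine ⟨fun m => ?_, by simpa using hc.2.2⟩
  obtain ⟨p, hp, hps⟩ := hs.1 m
  refine ⟨p.derivative, p.natDegree_derivative_le.trans (by omega), fun x hx => ?_⟩
  have hsub : Icc (lam m.castSucc) (lam m.succ) ⊆ dom lam :=
    Icc_subset_Icc (hlam.monotone (Fin.zero_le _)) (hlam.monotone (Fin.le_last _))
  have h1 := ((hc.1 x (hsub hx)).hasDerivWithinAt).mono hsub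
  have h2 := ((p.hasDerivAt x).hasDerivWithinAt (s := Icc (lam m.castSucc) (lam m.succ))).congr
    hps (hps x hx)
  exact (uniqueDiffOn_Icc (hlam m.castSucc_lt_succ) x hx).eq_deriv _ h1 h2

theorem bspline_one (hlam : StrictMono lam) (m : Fin (g + 1)) {x : ℝ}
    (hx : x ∈ Icc (lam m.castSucc) (lam m.succ)) (p : Fin (g + 2)) :
    bspline lam 1 ((p : ℤ) - 1) x =
      (if p = m.succ then (x - lam m.castSucc) / (lam m.succ - lam m.castSucc) else 0) +
      (if p = m.castSucc then (lam m.succ - x) / (lam m.succ - lam m.castSucc) else 0) := by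
  rw [bspline_succ_eq_bpoly hlam 0 _ m
    (by rwa [extKnot_castSucc, extKnot_succ]), bpoly_eval_succ]
  simp only [bpoly]
  rw [← extKnot_succ (lam := lam), ← extKnot_castSucc (lam := lam)]
  have h1 : ((p : ℤ) - 1 = m) ↔ p = m.succ := by
    rw [Fin.ext_iff, Fin.val_succ]; omega
  have h2 : ((p : ℤ) - 1 + 1 = m) ↔ p = m.castSucc := by
    rw [Fin.ext_iff, Fin.val_castSucc]; omega
  simp only [h1, h2]
  congr 1
  · split_ifs with h
    · subst h; simp
    · simp
  · split_ifs with h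
    · subst h
      have : (m : ℤ) - 1 + 2 = m + 1 := by ring
      simp [this]
    · simp

theorem IsSpline.exists_eq_sum_of_one (hlam : StrictMono lam) {s : ℝ → ℝ}
    (hs : IsSpline 1 lam s) : ∃ c : Fin (g + 2) → ℝ, ∀ x ∈ dom lam,
      s x = ∑ p, c p * bspline lam 1 ((p : ℤ) - 1) x := by
  refine ⟨fun p => s (lam p), fun x hx => ?_⟩
  obtain ⟨m, hm⟩ := exists_mem_Icc_extKnot hlam hx
  rw [extKnot_castSucc, extKnot_succ] at hm
  obtain ⟨p, hp, hps⟩ := hs.1 m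
  simp only [bspline_one hlam m hm, mul_add, Finset.sum_add_distrib, mul_ite, mul_zero,
    Finset.sum_ite_eq', Finset.mem_univ, if_true]
  have hlt := hlam m.castSucc_lt_succ
  rw [hps x hm, hps _ (left_mem_Icc.2 hlt.le), hps _ (right_mem_Icc.2 hlt.le)]
  rw [Polynomial.eq_X_add_C_of_natDegree_le_one hp]
  simp only [Polynomial.eval_add, Polynomial.eval_mul, Polynomial.eval_C, Polynomial.eval_X]
  have : lam m.succ - lam m.castSucc ≠ 0 := by linarith
  field_simp
  ring

theorem exists_forward_difference_eq {N : ℕ} (c0 : ℝ) (e : Fin N → ℝ) :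
    ∃ c : Fin (N + 1) → ℝ, c 0 = c0 ∧ ∀ p : Fin N, c p.succ - c p.castSucc = e p := by
  induction N with
  | zero => exact ⟨fun _ => c0, rfl, fun p => p.elim0⟩
  | succ N ih =>
    obtain ⟨c, hc0, hc⟩ := ih (fun p => e p.castSucc)
    refine ⟨Fin.snoc c (c (Fin.last N) + e (Fin.last N)), ?_, fun p => ?_⟩
    · rw [← Fin.castSucc_zero, Fin.snoc_castSucc, hc0]
    · refine Fin.lastCases ?_ (fun q => ?_) p
      · rw [Fin.succ_last, Fin.snoc_last, Fin.snoc_castSucc]; ring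
      · rw [Fin.succ_castSucc, Fin.snoc_castSucc, Fin.snoc_castSucc, hc]

/-- The B-splines span the univariate splines. -/
theorem IsSpline.exists_eq_sum (hlam : StrictMono lam) {k : ℕ} (hk : 0 < k) {s : ℝ → ℝ}
    (hs : IsSpline k lam s) : ∃ c : Fin (g + k + 1) → ℝ, ∀ x ∈ dom lam,
      s x = ∑ p, c p * bspline lam k ((p : ℤ) - k) x := by
  obtain ⟨d, rfl⟩ := Nat.exists_eq_succ_of_ne_zero hk.ne'
  induction d generalizing s with
  | zero => simpa using hs.exists_eq_sum_of_one hlam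
  | succ d ih =>
    obtain ⟨e, he⟩ := ih (by omega) (hs.derivWithin hlam)
    obtain ⟨c, hc0, hc⟩ := exists_forward_difference_eq (s (lam 0))
      (fun p : Fin (g + d + 2) =>
        e p * (extKnot lam (p + 1) - extKnot lam (p - (d + 1))) / (d + 2))
    refine ⟨c, ?_⟩
    have hd : DifferentiableOn ℝ s (dom lam) :=
      hs.2.differentiableOn (by simp)
    have hderiv : ∀ x ∈ dom lam, HasDerivWithinAt (fun x => s x -
        ∑ p, c p * bspline lam (d + 2) ((p : ℤ) - (d + 2 : ℕ)) x) 0 (dom lam) x := by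
      intro x hx
      refine ((hd x hx).hasDerivWithinAt.sub
        (sum_bspline_hasDerivWithinAt hlam d c x)).congr_deriv ?_
      rw [he x hx, sub_eq_zero]
      refine Finset.sum_congr rfl fun p _ => ?_
      rw [hc]
      have hp := p.2
      have := extKnot_lt hlam (show (p : ℤ) - (d + 1) < p + 1 by omega) (by omega) (by omega)
      have h3 : extKnot lam (p + 1) - extKnot lam (p - (d + 1)) ≠ 0 := by linarith
      congr 1
      field_simp
    have hconst := constant_of_derivWithin_zero (a := lam 0) (b := lam (Fin.last (g + 1)))
      (fun x hx => (hderiv x hx).differentiableWithinAt)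
      (fun x hx => (hderiv x (Ico_subset_Icc_self hx)).derivWithin
        (uniqueDiffOn_dom hlam x (Ico_subset_Icc_self hx)))
    intro x hx
    have h1 := hconst x hx
    have h2 : s (lam 0) - ∑ p, c p * bspline lam (d + 2) ((p : ℤ) - (d + 2 : ℕ)) (lam 0) = 0 := by
      simp only [bspline_zero hlam]
      rw [Fin.sum_univ_succ, Finset.sum_eq_zero]
      · simp [hc0]
      · intro p _
        rw [if_neg, mul_zero]
        rw [Fin.val_succ]
        omega
    rw [h2, sub_eq_zero] at h1
    exact h1

end Univariate

/-! ### Matrices -/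

theorem diffMat_mulVec {M N : ℕ} (hM : M = N + 1) (c : Fin M → ℝ) (p : Fin N) :
    (diffMat N M *ᵥ c) p = c ⟨p + 1, by omega⟩ - c ⟨p, by omega⟩ := by
  subst hM
  have h : ∀ q : Fin (N + 1), diffMat N (N + 1) p q * c q =
      (if q = p.succ then c q else 0) - (if q = p.castSucc then c q else 0) := by
    intro q
    have hp := p.2
    simp only [diffMat, Matrix.of_apply, Fin.ext_iff, Fin.val_succ, Fin.val_castSucc]
    split_ifs <;> first | omega | simp
  simp only [Matrix.mulVec, dotProduct, h, Finset.sum_sub_distrib, Finset.sum_ite_eq',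
    Finset.mem_univ, if_true]
  rfl

section Univariate

variable {g : ℕ} {lam : Fin (g + 2) → ℝ}

theorem scaleMat_mulVec (k : ℕ) (j : ℕ) (c : Fin (g + k + 1 - j) → ℝ) (p : Fin (g + k + 1 - j)) :
    (scaleMat k lam j *ᵥ c) p =
      ((k : ℝ) + 1 - j) / (extKnot lam (p + 1) - extKnot lam (p - k + j)) * c p := by
  simp only [scaleMat, Matrix.smul_mulVec, Pi.smul_apply, Matrix.mulVec_diagonal, smul_eq_mul]
  rw [show (p : ℤ) - k + j + k + 1 - j = p + 1 by ring]
  ring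

theorem sum_bspline_hasDerivWithinAt_of_eq (hlam : StrictMono lam) {M N D : ℕ} (hD : 2 ≤ D)
    (hM : M = g + D + 1) (hN : N = g + D) {o o' : ℤ} (ho : o = -D) (ho' : o' = -D + 1)
    (c : Fin M → ℝ) (c' : Fin N → ℝ)
    (hc : ∀ p : Fin N, c' p = (D : ℝ) / (extKnot lam (p + 1) - extKnot lam (p + o')) *
      (c ⟨p + 1, by omega⟩ - c ⟨p, by omega⟩)) (x : ℝ) :
    HasDerivWithinAt (fun x => ∑ p, c p * bspline lam D ((p : ℤ) + o) x)
      (∑ p, c' p * bspline lam (D - 1) ((p : ℤ) + o') x) (dom lam) x := by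
  obtain ⟨d, rfl⟩ := Nat.exists_eq_add_of_le' hD
  subst hM hN ho ho'
  refine (sum_bspline_hasDerivWithinAt hlam d c x).congr_deriv ?_
  refine Finset.sum_congr rfl fun p _ => ?_
  rw [hc]
  have e : (p : ℤ) + (-((d + 2 : ℕ) : ℤ) + 1) = p - (d + 1) := by push_cast; ring
  rw [e]
  push_cast
  rfl

/-- The `u`-th derivative of a spline of degree `k` has the B-spline coefficients `S_u c`. -/
theorem iteratedDerivWithin_sum_bspline (hlam : StrictMono lam) {k u : ℕ} (hk : 0 < k)
    (hu : u ≤ k - 1) (c : Fin (g + k + 1) → ℝ) {x : ℝ} (hx : x ∈ dom lam) :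
    iteratedDerivWithin u (fun x => ∑ p, c p * bspline lam k ((p : ℤ) - k) x) (dom lam) x =
      ∑ p, (derivMat k lam u *ᵥ c) p * bspline lam (k - u) ((p : ℤ) - k + u) x := by
  induction u generalizing x with
  | zero => simp [derivMat]
  | succ u ih =>
    rw [iteratedDerivWithin_succ, derivWithin_congr (fun x hx => ih (by omega) hx)
      (ih (by omega) hx)]
    have h := sum_bspline_hasDerivWithinAt_of_eq hlam (M := g + k + 1 - u)
      (N := g + k + 1 - (u + 1)) (D := k - u) (o := -k + u) (o' := -k + (u + 1 : ℕ))
      (by omega) (by omega) (by omega) (by omega) (by omega) (derivMat k lam u *ᵥ c)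
      (derivMat k lam (u + 1) *ᵥ c) (fun p => ?_) x
    · simp only [← add_assoc, ← sub_eq_add_neg] at h
      rw [h.derivWithin (uniqueDiffOn_dom hlam x hx), Nat.sub_sub]
    · rw [derivMat, ← Matrix.mulVec_mulVec, ← Matrix.mulVec_mulVec, scaleMat_mulVec,
        diffMat_mulVec (by omega)]
      congr 2
      · rw [Nat.cast_sub (by omega)]
        push_cast
        ring
      · congr 2
        ring

end Univariate

section Tensor

variable {g h : ℕ} {lam : Fin (g + 2) → ℝ} {mu : Fin (h + 2) → ℝ}

theorem tensorSpline_apply (k l : ℕ) (β : Fin (h + l + 1) × Fin (g + k + 1) → ℝ) (x y : ℝ) :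
    tensorSpline k l lam mu β x y = ∑ r, β r *
      (bspline lam k ((r.2 : ℤ) - k) x * bspline mu l ((r.1 : ℤ) - l) y) := by
  simp only [tensorSpline, Matrix.mulVec, dotProduct, Matrix.kroneckerMap_apply, colloc,
    Matrix.of_apply]
  exact Finset.sum_congr rfl fun r _ => by ring

theorem tensorSpline_sub (k l : ℕ) (β γ : Fin (h + l + 1) × Fin (g + k + 1) → ℝ) (x y : ℝ) :
    tensorSpline k l lam mu (β - γ) x y =
      tensorSpline k l lam mu β x y - tensorSpline k l lam mu γ x y := by
  simp [tensorSpline, Matrix.mulVec_sub]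

theorem tensorSpline_data {n m : ℕ} (k l : ℕ) (x : Fin n → ℝ) (y : Fin m → ℝ)
    (β : Fin (h + l + 1) × Fin (g + k + 1) → ℝ) (j : Fin m) (i : Fin n) :
    (tensorB k l lam mu x y *ᵥ β) (j, i) = tensorSpline k l lam mu β (x i) (y j) := rfl

theorem kronecker_mulVec_apply {a b c d : Type*} [Fintype b] [Fintype d] (A : Matrix a b ℝ)
    (B : Matrix c d ℝ) (v : b × d → ℝ) (i : a) (j : c) :
    ((A ⊗ₖ B) *ᵥ v) (i, j) = (A *ᵥ fun q => (B *ᵥ fun p => v (q, p)) j) i := by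
  simp only [Matrix.mulVec, dotProduct, Matrix.kroneckerMap_apply, Fintype.sum_prod_type,
    Finset.mul_sum, mul_assoc]

theorem mixedDeriv_tensorSpline (hlam : StrictMono lam) (hmu : StrictMono mu) {k l u v : ℕ}
    (hk : 0 < k) (hl : 0 < l) (hu : u ≤ k - 1) (hv : v ≤ l - 1)
    (β : Fin (h + l + 1) × Fin (g + k + 1) → ℝ) {x y : ℝ} (hx : x ∈ dom lam) (hy : y ∈ dom mu) :
    mixedDeriv lam mu u v (tensorSpline k l lam mu β) x y =
      ∑ r, (tensorS k l lam mu u v *ᵥ β) r * (bspline lam (k - u) ((r.2 : ℤ) - k + u) x *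
        bspline mu (l - v) ((r.1 : ℤ) - l + v) y) := by
  have h1 : ∀ x', iteratedDerivWithin v (fun y' => tensorSpline k l lam mu β x' y') (dom mu) y =
      ∑ p : Fin (g + k + 1), (∑ q, (derivMat l mu v *ᵥ fun j => β (j, p)) q *
        bspline mu (l - v) ((q : ℤ) - l + v) y) * bspline lam k ((p : ℤ) - k) x' := by
    intro x'
    have h2 : (fun y' => tensorSpline k l lam mu β x' y') = fun y' =>
        ∑ q : Fin (h + l + 1), (∑ p : Fin (g + k + 1), β (q, p) *
          bspline lam k ((p : ℤ) - k) x') * bspline mu l ((q : ℤ) - l) y' := by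
      funext y'
      rw [tensorSpline_apply, Fintype.sum_prod_type]
      simp only [Finset.sum_mul]
      exact Finset.sum_congr rfl fun _ _ => Finset.sum_congr rfl fun _ _ => by ring
    rw [h2, iteratedDerivWithin_sum_bspline hmu hl hv _ hy]
    simp only [Matrix.mulVec, dotProduct, Finset.sum_mul, Finset.mul_sum]
    rw [Finset.sum_comm_cycle]
    refine Finset.sum_congr rfl fun _ _ => ?_
    refine Finset.sum_congr rfl fun _ _ => Finset.sum_congr rfl fun _ _ => ?_
    ring
  unfold mixedDeriv
  rw [funext h1, iteratedDerivWithin_sum_bspline hlam hk hu _ hx, Fintype.sum_prod_type]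
  unfold tensorS
  simp only [kronecker_mulVec_apply]
  simp only [Matrix.mulVec, dotProduct, Finset.sum_mul, Finset.mul_sum]
  conv_lhs => enter [2, p']; rw [Finset.sum_comm]
  rw [Finset.sum_comm]
  refine Finset.sum_congr rfl fun q _ => Finset.sum_congr rfl fun p' _ => ?_
  rw [Finset.sum_comm]
  refine Finset.sum_congr rfl fun j _ => Finset.sum_congr rfl fun p _ => ?_
  ring

end Tensor

section Tensor

variable {g h : ℕ} {lam : Fin (g + 2) → ℝ} {mu : Fin (h + 2) → ℝ}

theorem integralΩ_congr {s t : ℝ → ℝ → ℝ} (hst : ∀ x ∈ dom lam, ∀ y ∈ dom mu, s x y = t x y) :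
    integralΩ lam mu s = integralΩ lam mu t :=
  setIntegral_congr_fun (measurableSet_Icc.prod measurableSet_Icc) fun z hz =>
    hst z.1 hz.1 z.2 hz.2

theorem integralΩ_sum_mul {ι : Type*} [Fintype ι] (β : ι → ℝ) (p q : ι → ℝ → ℝ)
    (hp : ∀ r, ContinuousOn (p r) (dom lam)) (hq : ∀ r, ContinuousOn (q r) (dom mu)) :
    integralΩ lam mu (fun x y => ∑ r, β r * (p r x * q r y)) =
      ∑ r, β r * ((∫ x in dom lam, p r x) * ∫ y in dom mu, q r y) := by
  unfold integralΩ
  rw [integral_finsetSum]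
  · refine Finset.sum_congr rfl fun r _ => ?_
    rw [integral_const_mul, Measure.volume_eq_prod, setIntegral_prod_mul]
  · intro r _
    refine ContinuousOn.integrableOn_compact (isCompact_Icc.prod isCompact_Icc) ?_
    refine continuousOn_const.mul (ContinuousOn.mul ?_ ?_)
    · exact (hp r).comp continuousOn_fst fun z hz => hz.1
    · exact (hq r).comp continuousOn_snd fun z hz => hz.2

theorem bspline_continuousOn_of_pos (hlam : StrictMono lam) {k : ℕ} (hk : 0 < k) (i : ℤ) :
    ContinuousOn (bspline lam k i) (dom lam) := by
  obtain ⟨d, rfl⟩ := Nat.exists_eq_succ_of_ne_zero hk.ne'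
  exact bspline_continuousOn hlam d i

theorem integralΩ_sum_bspline_sq (hlam : StrictMono lam) (hmu : StrictMono mu) {k l u v : ℕ}
    (hk : 0 < k) (hl : 0 < l) (hu : u ≤ k - 1) (hv : v ≤ l - 1)
    (γ : Fin (h + l + 1 - v) × Fin (g + k + 1 - u) → ℝ) :
    integralΩ lam mu (fun x y => (∑ r, γ r * (bspline lam (k - u) ((r.2 : ℤ) - k + u) x *
        bspline mu (l - v) ((r.1 : ℤ) - l + v) y)) ^ 2) =
      γ ⬝ᵥ tensorM k l lam mu u v *ᵥ γ := by
  have hc := fun i => bspline_continuousOn_of_pos hlam (show 0 < k - u by omega) i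
  have hd := fun i => bspline_continuousOn_of_pos hmu (show 0 < l - v by omega) i
  have e := integralΩ_sum_mul (lam := lam) (mu := mu)
    (fun r : (Fin (h + l + 1 - v) × Fin (g + k + 1 - u)) ×
      (Fin (h + l + 1 - v) × Fin (g + k + 1 - u)) => γ r.1 * γ r.2)
    (fun r x => bspline lam (k - u) ((r.1.2 : ℤ) - k + u) x *
      bspline lam (k - u) ((r.2.2 : ℤ) - k + u) x)
    (fun r y => bspline mu (l - v) ((r.1.1 : ℤ) - l + v) y *
      bspline mu (l - v) ((r.2.1 : ℤ) - l + v) y)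
    (fun r => (hc _).mul (hc _)) (fun r => (hd _).mul (hd _))
  refine Eq.trans ?_ (e.trans ?_)
  · congr 1
    funext x y
    rw [sq, Finset.sum_mul_sum]
    symm
    rw [Fintype.sum_prod_type]
    exact Finset.sum_congr rfl fun _ _ => Finset.sum_congr rfl fun _ _ => by ring
  · rw [Fintype.sum_prod_type]
    simp only [dotProduct, Matrix.mulVec, Finset.mul_sum, tensorM, Matrix.kroneckerMap_apply,
      gramMat, Matrix.of_apply]
    exact Finset.sum_congr rfl fun _ _ => Finset.sum_congr rfl fun _ _ => by ring

theorem integralΩ_mixedDeriv_sq (hlam : StrictMono lam) (hmu : StrictMono mu) {k l u v : ℕ}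
    (hk : 0 < k) (hl : 0 < l) (hu : u ≤ k - 1) (hv : v ≤ l - 1)
    (β : Fin (h + l + 1) × Fin (g + k + 1) → ℝ) :
    integralΩ lam mu (fun x y => mixedDeriv lam mu u v (tensorSpline k l lam mu β) x y ^ 2) =
      (tensorS k l lam mu u v *ᵥ β) ⬝ᵥ tensorM k l lam mu u v *ᵥ (tensorS k l lam mu u v *ᵥ β) := by
  rw [← integralΩ_sum_bspline_sq hlam hmu hk hl hu hv]
  refine integralΩ_congr fun x hx y hy => ?_
  rw [mixedDeriv_tensorSpline hlam hmu hk hl hu hv β hx hy]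

theorem tensorM_nonneg (hlam : StrictMono lam) (hmu : StrictMono mu) {k l u v : ℕ}
    (hk : 0 < k) (hl : 0 < l) (hu : u ≤ k - 1) (hv : v ≤ l - 1)
    (γ : Fin (h + l + 1 - v) × Fin (g + k + 1 - u) → ℝ) :
    0 ≤ γ ⬝ᵥ tensorM k l lam mu u v *ᵥ γ := by
  rw [← integralΩ_sum_bspline_sq hlam hmu hk hl hu hv]
  exact integral_nonneg fun _ => sq_nonneg _

theorem gramMat_transpose (k u : ℕ) : (gramMat k lam u)ᵀ = gramMat k lam u := by
  ext p q
  simp only [gramMat, Matrix.transpose_apply, Matrix.of_apply, mul_comm]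

theorem tensorM_transpose (k l u v : ℕ) :
    (tensorM k l lam mu u v)ᵀ = tensorM k l lam mu u v := by
  rw [tensorM, ← Matrix.kroneckerMap_transpose, gramMat_transpose, gramMat_transpose]

theorem mixedDeriv_congr {u v : ℕ} {s t : ℝ → ℝ → ℝ}
    (hst : ∀ x ∈ dom lam, ∀ y ∈ dom mu, s x y = t x y) {x y : ℝ} (hx : x ∈ dom lam)
    (hy : y ∈ dom mu) : mixedDeriv lam mu u v s x y = mixedDeriv lam mu u v t x y :=
  iteratedDerivWithin_congr (fun x' hx' => iteratedDerivWithin_congr (hst x' hx') hy) hx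

theorem J_congr {n m : ℕ} {x : Fin n → ℝ} {y : Fin m → ℝ} (hx : ∀ i, x i ∈ dom lam)
    (hy : ∀ j, y j ∈ dom mu) (F : Matrix (Fin n) (Fin m) ℝ) (α : ℝ) (u v : ℕ) {s t : ℝ → ℝ → ℝ}
    (hst : ∀ x ∈ dom lam, ∀ y ∈ dom mu, s x y = t x y) :
    J lam mu x y F α u v s = J lam mu x y F α u v t := by
  unfold J
  congr 2
  · exact Finset.sum_congr rfl fun i _ => Finset.sum_congr rfl fun j _ => by
      rw [hst _ (hx i) _ (hy j)]
  · exact integralΩ_congr fun x' hx' y' hy' => by rw [mixedDeriv_congr hst hx' hy']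

theorem J_tensorSpline {n m : ℕ} (hlam : StrictMono lam) (hmu : StrictMono mu) {k l u v : ℕ}
    (hk : 0 < k) (hl : 0 < l) (hu : u ≤ k - 1) (hv : v ≤ l - 1)
    (x : Fin n → ℝ) (y : Fin m → ℝ) (F : Matrix (Fin n) (Fin m) ℝ) (α : ℝ)
    (β : Fin (h + l + 1) × Fin (g + k + 1) → ℝ) :
    J lam mu x y F α u v (tensorSpline k l lam mu β) =
      α * ((F.vec - tensorB k l lam mu x y *ᵥ β) ⬝ᵥ (F.vec - tensorB k l lam mu x y *ᵥ β)) +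
      (1 - α) * ((tensorS k l lam mu u v *ᵥ β) ⬝ᵥ
        tensorM k l lam mu u v *ᵥ (tensorS k l lam mu u v *ᵥ β)) := by
  unfold J
  rw [integralΩ_mixedDeriv_sq hlam hmu hk hl hu hv]
  congr 2
  rw [dotProduct, Fintype.sum_prod_type, Finset.sum_comm]
  exact Finset.sum_congr rfl fun j _ => Finset.sum_congr rfl fun i _ => by
    rw [Pi.sub_apply, tensorSpline_data, sq]; rfl

/-! ### Tensor product splines and B-splines -/

theorem IsSpline.const_mul {k : ℕ} {s : ℝ → ℝ} (hs : IsSpline k lam s) (a : ℝ) :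
    IsSpline k lam (fun x => a * s x) := by
  refine ⟨fun m => ?_, contDiffOn_const.mul hs.2⟩
  obtain ⟨p, hp, hps⟩ := hs.1 m
  exact ⟨Polynomial.C a * p, (Polynomial.natDegree_C_mul_le a p).trans hp,
    fun x hx => by simp [hps x hx]⟩

theorem isTensorSpline_tensorSpline (hlam : StrictMono lam) (hmu : StrictMono mu) {k l : ℕ}
    (hk : 0 < k) (hl : 0 < l) (β : Fin (h + l + 1) × Fin (g + k + 1) → ℝ) :
    IsTensorSpline k l lam mu (tensorSpline k l lam mu β) := by
  let e := Fintype.equivFin (Fin (h + l + 1) × Fin (g + k + 1))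
  refine ⟨_, fun r x => β (e.symm r) * bspline lam k (((e.symm r).2 : ℤ) - k) x,
    fun r => bspline mu l (((e.symm r).1 : ℤ) - l),
    fun r => (isSpline_bspline hlam hk _).const_mul _,
    fun r => isSpline_bspline hmu hl _, fun x _ y _ => ?_⟩
  rw [tensorSpline_apply]
  refine Fintype.sum_equiv e _ _ fun r => ?_
  simp only [Equiv.symm_apply_apply]
  ring

/-- The products of B-splines span the tensor product splines. -/
theorem IsTensorSpline.exists_eq (hlam : StrictMono lam) (hmu : StrictMono mu) {k l : ℕ}
    (hk : 0 < k) (hl : 0 < l) {s : ℝ → ℝ → ℝ} (hs : IsTensorSpline k l lam mu s) :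
    ∃ β, ∀ x ∈ dom lam, ∀ y ∈ dom mu, s x y = tensorSpline k l lam mu β x y := by
  obtain ⟨N, p, q, hp, hq, hs⟩ := hs
  choose c hc using fun r => (hp r).exists_eq_sum hlam hk
  choose e he using fun r => (hq r).exists_eq_sum hmu hl
  refine ⟨fun r => ∑ i, c i r.2 * e i r.1, fun x hx y hy => ?_⟩
  rw [hs x hx y hy, tensorSpline_apply]
  simp only [hc _ x hx, he _ y hy, Finset.sum_mul]
  symm
  rw [Finset.sum_comm]
  refine Finset.sum_congr rfl fun i _ => ?_
  rw [Fintype.sum_prod_type_right]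
  simp only [Finset.mul_sum]
  exact Finset.sum_congr rfl fun _ _ => Finset.sum_congr rfl fun _ _ => by ring

/-! ### The zero integral condition -/

theorem integralΩ_tensorSpline (hlam : StrictMono lam) (hmu : StrictMono mu) {k l : ℕ}
    (hk : 0 < k) (hl : 0 < l) (β : Fin (h + l + 1) × Fin (g + k + 1) → ℝ) :
    integralΩ lam mu (tensorSpline k l lam mu β) = ∑ r, β r *
      ((∫ x in dom lam, bspline lam k ((r.2 : ℤ) - k) x) *
        ∫ y in dom mu, bspline mu l ((r.1 : ℤ) - l) y) := by
  rw [← integralΩ_sum_mul]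
  · congr 1
    funext x y
    exact tensorSpline_apply k l β x y
  · exact fun r => bspline_continuousOn_of_pos hlam hk _
  · exact fun r => bspline_continuousOn_of_pos hmu hl _

theorem integral_bspline_ne_zero (hlam : StrictMono lam) {k : ℕ} (hk : 0 < k)
    (p : Fin (g + k + 1)) : ∫ x in dom lam, bspline lam k ((p : ℤ) - k) x ≠ 0 := by
  rw [integral_bspline hlam hk _ (by omega) (by omega)]
  have := extKnot_lt hlam (show (p : ℤ) - k < p - k + k + 1 by omega) (by omega) (by omega)
  have h2 : (0 : ℝ) < k + 1 := by positivity
  exact (div_pos (by linarith) h2).ne'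

/-- `D` divides the coefficients by the integrals of the B-splines. -/
theorem scaleMat_zero_mulVec (hlam : StrictMono lam) {k : ℕ} (hk : 0 < k)
    (c : Fin (g + k + 1) → ℝ) (p : Fin (g + k + 1)) :
    ((scaleMat k lam 0 : Matrix (Fin (g + k + 1)) (Fin (g + k + 1)) ℝ) *ᵥ c) p =
      (∫ x in dom lam, bspline lam k ((p : ℤ) - k) x)⁻¹ * c p := by
  rw [integral_bspline hlam hk _ (by omega) (by omega), inv_div]
  refine (scaleMat_mulVec k 0 c p).trans ?_
  rw [sub_add_cancel]
  simp

theorem tensorD_mulVec (hlam : StrictMono lam) (hmu : StrictMono mu) {k l : ℕ}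
    (hk : 0 < k) (hl : 0 < l) (w : Fin (h + l + 1) × Fin (g + k + 1) → ℝ)
    (r : Fin (h + l + 1) × Fin (g + k + 1)) :
    (tensorD k l lam mu *ᵥ w) r =
      ((∫ x in dom lam, bspline lam k ((r.2 : ℤ) - k) x) *
        ∫ y in dom mu, bspline mu l ((r.1 : ℤ) - l) y)⁻¹ * w r := by
  obtain ⟨q, p⟩ := r
  unfold tensorD
  rw [kronecker_mulVec_apply, scaleMat_zero_mulVec hmu hl, scaleMat_zero_mulVec hlam hk, mul_inv]
  ring

theorem integralΩ_tensorSpline_tensorD (hlam : StrictMono lam) (hmu : StrictMono mu) {k l : ℕ}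
    (hk : 0 < k) (hl : 0 < l) (w : Fin (h + l + 1) × Fin (g + k + 1) → ℝ) :
    integralΩ lam mu (tensorSpline k l lam mu (tensorD k l lam mu *ᵥ w)) = ∑ r, w r := by
  rw [integralΩ_tensorSpline hlam hmu hk hl]
  refine Finset.sum_congr rfl fun r _ => ?_
  rw [tensorD_mulVec hlam hmu hk hl]
  have h1 := integral_bspline_ne_zero hlam hk r.2
  have h2 := integral_bspline_ne_zero hmu hl r.1
  field_simp

theorem exists_tensorD_mulVec_eq (hlam : StrictMono lam) (hmu : StrictMono mu) {k l : ℕ}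
    (hk : 0 < k) (hl : 0 < l) (β : Fin (h + l + 1) × Fin (g + k + 1) → ℝ) :
    ∃ w, tensorD k l lam mu *ᵥ w = β := by
  refine ⟨fun r => ((∫ x in dom lam, bspline lam k ((r.2 : ℤ) - k) x) *
        ∫ y in dom mu, bspline mu l ((r.1 : ℤ) - l) y) * β r, ?_⟩
  funext r
  rw [tensorD_mulVec hlam hmu hk hl]
  have h1 := integral_bspline_ne_zero hlam hk r.2
  have h2 := integral_bspline_ne_zero hmu hl r.1
  field_simp

theorem sum_succ_sub_castSucc {N : ℕ} (c : Fin (N + 1) → ℝ) :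
    ∑ p : Fin N, (c p.succ - c p.castSucc) = c (Fin.last N) - c 0 := by
  have h1 := Fin.sum_univ_succ c
  have h2 := Fin.sum_univ_castSucc c
  rw [Finset.sum_sub_distrib]
  linarith

theorem tensorK_mulVec (k l : ℕ) (C : Fin (h + l + 2) × Fin (g + k + 2) → ℝ)
    (q : Fin (h + l + 1)) (p : Fin (g + k + 1)) :
    (tensorK k l g h *ᵥ C) (q, p) = (C (q.succ, p.succ) - C (q.succ, p.castSucc)) -
      (C (q.castSucc, p.succ) - C (q.castSucc, p.castSucc)) := by
  unfold tensorK
  rw [kronecker_mulVec_apply, diffMat_mulVec rfl, diffMat_mulVec rfl, diffMat_mulVec rfl]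
  rfl

theorem sum_tensorK_mulVec (k l : ℕ) (C : Fin (h + l + 2) × Fin (g + k + 2) → ℝ) :
    ∑ r, (tensorK k l g h *ᵥ C) r = C (Fin.last _, Fin.last _) - C (Fin.last _, 0) -
      C (0, Fin.last _) + C (0, 0) := by
  rw [Fintype.sum_prod_type]
  simp only [tensorK_mulVec]
  have h1 : ∀ q : Fin (h + l + 1), ∑ p : Fin (g + k + 1),
      ((C (q.succ, p.succ) - C (q.succ, p.castSucc)) -
      (C (q.castSucc, p.succ) - C (q.castSucc, p.castSucc))) =
      (C (q.succ, Fin.last _) - C (q.succ, 0)) -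
        (C (q.castSucc, Fin.last _) - C (q.castSucc, 0)) := by
    intro q
    rw [Finset.sum_sub_distrib, sum_succ_sub_castSucc (fun p => C (q.succ, p)),
      sum_succ_sub_castSucc (fun p => C (q.castSucc, p))]
  simp only [h1]
  rw [sum_succ_sub_castSucc (fun q => C (q, Fin.last _) - C (q, 0))]
  ring

theorem exists_tensorK_mulVec_eq (k l : ℕ) (w : Fin (h + l + 1) × Fin (g + k + 1) → ℝ) :
    ∃ C, tensorK k l g h *ᵥ C = w := by
  choose e _ he using fun q => exists_forward_difference_eq 0 (fun p => w (q, p))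
  choose C _ hC using fun p => exists_forward_difference_eq 0 (fun q => e q p)
  refine ⟨fun r => C r.2 r.1, ?_⟩
  funext ⟨q, p⟩
  rw [tensorK_mulVec]
  have h1 := hC p.succ q
  have h2 := hC p.castSucc q
  have h3 := he q p
  linarith

theorem elimMat_mulVec (k l : ℕ) {C : Fin (h + l + 2) × Fin (g + k + 2) → ℝ}
    (hC : C (0, 0) = C (Fin.last _, 0) + C (0, Fin.last _) - C (Fin.last _, Fin.last _)) :
    (elimMat k l g h *ᵥ fun s => C s.1) = C := by
  have key : ∀ r : Fin (h + l + 2) × Fin (g + k + 2), r ≠ (0, 0) →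
      ∑ s : RedIdx k l g h, (if s.1 = r then C s.1 else 0) = C r := by
    intro r hr
    rw [Finset.sum_eq_single ⟨r, hr⟩]
    · simp
    · intro s _ hs
      rw [if_neg fun h => hs (Subtype.ext h)]
    · simp
  funext r
  simp only [Matrix.mulVec, dotProduct, elimMat, Matrix.of_apply]
  by_cases hr : r = (0, 0)
  · subst hr
    simp only [if_true, sub_mul, add_mul, ite_mul, one_mul, zero_mul, Finset.sum_sub_distrib,
      Finset.sum_add_distrib]
    rw [key _ (by simp [Fin.ext_iff]), key _ (by simp [Fin.ext_iff]),
      key _ (by simp [Fin.ext_iff]), hC]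
  · simp only [if_neg hr, ite_mul, one_mul, zero_mul]
    simp only [eq_comm (a := r)]
    exact key r hr

theorem elimMat_mulVec_zero (k l : ℕ) (c : RedIdx k l g h → ℝ) :
    (elimMat k l g h *ᵥ c) (0, 0) = (elimMat k l g h *ᵥ c) (Fin.last _, 0) +
      (elimMat k l g h *ᵥ c) (0, Fin.last _) - (elimMat k l g h *ᵥ c) (Fin.last _, Fin.last _) := by
  have h1 : ((Fin.last (h + l + 1), 0) : Fin (h + l + 2) × Fin (g + k + 2)) ≠ (0, 0) := by
    simp [Fin.ext_iff]
  have h2 : ((0, Fin.last (g + k + 1)) : Fin (h + l + 2) × Fin (g + k + 2)) ≠ (0, 0) := by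
    simp [Fin.ext_iff]
  have h3 : ((Fin.last (h + l + 1), Fin.last (g + k + 1)) :
      Fin (h + l + 2) × Fin (g + k + 2)) ≠ (0, 0) := by
    simp [Fin.ext_iff]
  simp only [Matrix.mulVec, dotProduct, elimMat, Matrix.of_apply, if_true, if_neg h1, if_neg h2,
    if_neg h3]
  rw [← Finset.sum_add_distrib, ← Finset.sum_sub_distrib]
  refine Finset.sum_congr rfl fun s _ => ?_
  simp only [eq_comm (b := s.1)]
  ring

theorem exists_redK_mulVec_eq_iff (k l : ℕ) (w : Fin (h + l + 1) × Fin (g + k + 1) → ℝ) :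
    (∃ c, redK k l g h *ᵥ c = w) ↔ ∑ r, w r = 0 := by
  constructor
  · rintro ⟨c, rfl⟩
    rw [redK, ← Matrix.mulVec_mulVec, sum_tensorK_mulVec, elimMat_mulVec_zero]
    ring
  · intro hw
    obtain ⟨C, rfl⟩ := exists_tensorK_mulVec_eq k l w
    rw [sum_tensorK_mulVec] at hw
    refine ⟨fun s => C s.1, ?_⟩
    rw [redK, ← Matrix.mulVec_mulVec, elimMat_mulVec k l (by linarith)]

theorem integralΩ_tensorSpline_eq_zero_iff (hlam : StrictMono lam) (hmu : StrictMono mu) {k l : ℕ}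
    (hk : 0 < k) (hl : 0 < l) (β : Fin (h + l + 1) × Fin (g + k + 1) → ℝ) :
    integralΩ lam mu (tensorSpline k l lam mu β) = 0 ↔
      ∃ c, β = (tensorD k l lam mu * redK k l g h) *ᵥ c := by
  constructor
  · intro hβ
    obtain ⟨w, rfl⟩ := exists_tensorD_mulVec_eq hlam hmu hk hl β
    rw [integralΩ_tensorSpline_tensorD hlam hmu hk hl] at hβ
    obtain ⟨c, rfl⟩ := (exists_redK_mulVec_eq_iff k l w).2 hβ
    exact ⟨c, Matrix.mulVec_mulVec _ _ _⟩
  · rintro ⟨c, rfl⟩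
    rw [← Matrix.mulVec_mulVec, integralΩ_tensorSpline_tensorD hlam hmu hk hl]
    exact (exists_redK_mulVec_eq_iff k l _).1 ⟨c, rfl⟩

end Tensor

/-! ### Penalized least squares -/

section LeastSquares

/-- `A⁺ r` solves `A c = r` if `A` is symmetric and `r` is orthogonal to the kernel of `A`. -/
theorem mulVec_pinv_mulVec {ι : Type*} [Fintype ι] {A : Matrix ι ι ℝ} (hA : Aᵀ = A) {r : ι → ℝ}
    (hr : ∀ w, A *ᵥ w = 0 → w ⬝ᵥ r = 0) : A *ᵥ (pinv A *ᵥ r) = r := by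
  obtain ⟨h1, -, h3, -⟩ := pinv_spec A
  have h4 : A * (A * pinv A) = A := by
    have := congrArg Matrix.transpose h1
    rwa [Matrix.transpose_mul, h3, hA] at this
  set w := r - A *ᵥ (pinv A *ᵥ r) with hw
  have hAw : A *ᵥ w = 0 := by
    rw [hw, Matrix.mulVec_sub, Matrix.mulVec_mulVec, Matrix.mulVec_mulVec, Matrix.mul_assoc, h4,
      sub_self]
  have hwr := hr w hAw
  have hwA : w ⬝ᵥ A *ᵥ (pinv A *ᵥ r) = 0 := by
    rw [Matrix.dotProduct_mulVec, ← Matrix.mulVec_transpose, hA, hAw, zero_dotProduct]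
  have hww : w ⬝ᵥ w = 0 := by
    nth_rewrite 2 [hw]
    rw [dotProduct_sub, hwr, hwA, sub_zero]
  exact (sub_eq_zero.1 (dotProduct_self_eq_zero.1 hww)).symm

variable {ι κ ρ : Type*} [Fintype ι] [Fintype κ] [Fintype ρ]

/-- The penalized least squares functional on coefficient vectors. -/
def penalizedLS (X : Matrix κ ι ℝ) (P : Matrix ρ ι ℝ) (M : Matrix ρ ρ ℝ) (f : κ → ℝ) (α : ℝ)
    (c : ι → ℝ) : ℝ :=
  α * ((f - X *ᵥ c) ⬝ᵥ (f - X *ᵥ c)) + (1 - α) * ((P *ᵥ c) ⬝ᵥ M *ᵥ (P *ᵥ c))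

variable {X : Matrix κ ι ℝ} {P : Matrix ρ ι ℝ} {M : Matrix ρ ρ ℝ} {α : ℝ}

theorem dotProduct_normalMat_mulVec (w c : ι → ℝ) :
    w ⬝ᵥ ((1 - α) • (Pᵀ * M * P) + α • (Xᵀ * X)) *ᵥ c =
      (1 - α) * ((P *ᵥ w) ⬝ᵥ M *ᵥ (P *ᵥ c)) + α * ((X *ᵥ w) ⬝ᵥ (X *ᵥ c)) := by
  rw [Matrix.add_mulVec, Matrix.smul_mulVec, Matrix.smul_mulVec, dotProduct_add, dotProduct_smul,
    dotProduct_smul, smul_eq_mul, smul_eq_mul, ← Matrix.mulVec_mulVec, ← Matrix.mulVec_mulVec,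
    ← Matrix.mulVec_mulVec, Matrix.dotProduct_mulVec w Pᵀ, Matrix.dotProduct_mulVec w Xᵀ,
    Matrix.vecMul_transpose, Matrix.vecMul_transpose]

theorem normalMat_mulVec_pinv (hM : Mᵀ = M) (hM0 : ∀ γ, 0 ≤ γ ⬝ᵥ M *ᵥ γ)
    (hα : α ∈ Ioo (0 : ℝ) 1) (f : κ → ℝ) :
    ((1 - α) • (Pᵀ * M * P) + α • (Xᵀ * X)) *ᵥ
      (pinv ((1 - α) • (Pᵀ * M * P) + α • (Xᵀ * X)) *ᵥ (α • Xᵀ *ᵥ f)) = α • Xᵀ *ᵥ f := by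
  refine mulVec_pinv_mulVec ?_ fun w hw => ?_
  · simp only [Matrix.transpose_add, Matrix.transpose_smul, Matrix.transpose_mul,
      Matrix.transpose_transpose, hM, Matrix.mul_assoc]
  · have h1 := dotProduct_normalMat_mulVec (X := X) (P := P) (M := M) (α := α) w w
    rw [hw, dotProduct_zero] at h1
    have h2 := mul_nonneg (sub_nonneg.2 hα.2.le) (hM0 (P *ᵥ w))
    have h3 : 0 ≤ (X *ᵥ w) ⬝ᵥ (X *ᵥ w) := Finset.sum_nonneg fun _ _ => mul_self_nonneg _
    have h4 : (X *ᵥ w) ⬝ᵥ (X *ᵥ w) = 0 := by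
      have := mul_nonneg hα.1.le h3
      have h5 : α * ((X *ᵥ w) ⬝ᵥ (X *ᵥ w)) = 0 := by linarith
      exact (mul_eq_zero.1 h5).resolve_left hα.1.ne'
    rw [dotProduct_smul, Matrix.dotProduct_mulVec, Matrix.vecMul_transpose,
      dotProduct_self_eq_zero.1 h4, zero_dotProduct, smul_zero]

theorem penalizedLS_eq_add (hM : Mᵀ = M) {f : κ → ℝ} {c₀ : ι → ℝ}
    (h₀ : ((1 - α) • (Pᵀ * M * P) + α • (Xᵀ * X)) *ᵥ c₀ = α • Xᵀ *ᵥ f) (c : ι → ℝ) :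
    penalizedLS X P M f α c = penalizedLS X P M f α c₀ +
      (α * ((X *ᵥ (c - c₀)) ⬝ᵥ (X *ᵥ (c - c₀))) +
        (1 - α) * ((P *ᵥ (c - c₀)) ⬝ᵥ M *ᵥ (P *ᵥ (c - c₀)))) := by
  obtain ⟨e, rfl⟩ : ∃ e, c = c₀ + e := ⟨c - c₀, by abel⟩
  have h1 := dotProduct_normalMat_mulVec (X := X) (P := P) (M := M) (α := α) e c₀
  rw [h₀, dotProduct_smul, Matrix.dotProduct_mulVec, Matrix.vecMul_transpose, smul_eq_mul] at h1
  have h2 : (P *ᵥ c₀) ⬝ᵥ M *ᵥ (P *ᵥ e) = (P *ᵥ e) ⬝ᵥ M *ᵥ (P *ᵥ c₀) := by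
    rw [Matrix.dotProduct_mulVec, ← Matrix.mulVec_transpose, hM, dotProduct_comm]
  have h3 := dotProduct_comm (X *ᵥ c₀) (X *ᵥ e)
  have h4 := dotProduct_comm f (X *ᵥ e)
  simp only [penalizedLS, add_sub_cancel_left, Matrix.mulVec_add, dotProduct_add, add_dotProduct,
    dotProduct_sub, sub_dotProduct, h2, h3, h4]
  linear_combination -2 * h1

end LeastSquares

theorem normalMat_mul {ι κ ρ τ : Type*} [Fintype ι] [Fintype κ] [Fintype ρ] [Fintype τ]
    (K : Matrix τ ι ℝ) (D : Matrix τ τ ℝ) (B : Matrix κ τ ℝ) (S : Matrix ρ τ ℝ)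
    (M : Matrix ρ ρ ℝ) (α : ℝ) :
    Kᵀ * Dᵀ * ((1 - α) • (Sᵀ * M * S) + α • (Bᵀ * B)) * D * K =
      (1 - α) • ((S * (D * K))ᵀ * M * (S * (D * K))) + α • ((B * (D * K))ᵀ * (B * (D * K))) := by
  simp only [Matrix.transpose_mul, Matrix.mul_add, Matrix.add_mul, Matrix.mul_smul,
    Matrix.smul_mul, Matrix.mul_assoc]

section Main

variable {k l g h n m : ℕ} {lam : Fin (g + 2) → ℝ} {mu : Fin (h + 2) → ℝ}

theorem optCoeff_eq (x : Fin n → ℝ) (y : Fin m → ℝ) (F : Matrix (Fin n) (Fin m) ℝ) (α : ℝ)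
    (u v : ℕ) :
    optCoeff k l lam mu x y F α u v =
      pinv ((1 - α) • ((tensorS k l lam mu u v * (tensorD k l lam mu * redK k l g h))ᵀ *
          tensorM k l lam mu u v * (tensorS k l lam mu u v * (tensorD k l lam mu * redK k l g h))) +
        α • ((tensorB k l lam mu x y * (tensorD k l lam mu * redK k l g h))ᵀ *
          (tensorB k l lam mu x y * (tensorD k l lam mu * redK k l g h)))) *ᵥ
      (α • (tensorB k l lam mu x y * (tensorD k l lam mu * redK k l g h))ᵀ *ᵥ F.vec) := by
  unfold optCoeff
  rw [normalMat_mul]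
  simp only [Matrix.transpose_mul, Matrix.mul_assoc]

theorem J_tensorSpline_eq_penalizedLS (hlam : StrictMono lam) (hmu : StrictMono mu) {u v : ℕ}
    (hk : 0 < k) (hl : 0 < l) (hu : u ≤ k - 1) (hv : v ≤ l - 1)
    (x : Fin n → ℝ) (y : Fin m → ℝ) (F : Matrix (Fin n) (Fin m) ℝ) (α : ℝ)
    {ι : Type*} [Fintype ι] (T : Matrix (Fin (h + l + 1) × Fin (g + k + 1)) ι ℝ) (c : ι → ℝ) :
    J lam mu x y F α u v (tensorSpline k l lam mu (T *ᵥ c)) =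
      penalizedLS (tensorB k l lam mu x y * T) (tensorS k l lam mu u v * T)
        (tensorM k l lam mu u v) F.vec α c := by
  rw [J_tensorSpline hlam hmu hk hl hu hv, penalizedLS, Matrix.mulVec_mulVec, Matrix.mulVec_mulVec]

/-- Admissible splines are those with coefficients `D K̃ c`. -/
theorem exists_eq_tensorSpline_of_integralΩ_eq_zero (hlam : StrictMono lam) (hmu : StrictMono mu)
    (hk : 0 < k) (hl : 0 < l) {s : ℝ → ℝ → ℝ} (hs : IsTensorSpline k l lam mu s)
    (hs0 : integralΩ lam mu s = 0) :
    ∃ c, ∀ x ∈ dom lam, ∀ y ∈ dom mu,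
      s x y = tensorSpline k l lam mu ((tensorD k l lam mu * redK k l g h) *ᵥ c) x y := by
  obtain ⟨β, hβ⟩ := hs.exists_eq hlam hmu hk hl
  rw [integralΩ_congr hβ, integralΩ_tensorSpline_eq_zero_iff hlam hmu hk hl] at hs0
  obtain ⟨c, rfl⟩ := hs0
  exact ⟨c, hβ⟩

end Main

end TensorSpline

end

theorem theorem6 {k l g h n m : ℕ} (hk : 0 < k) (hl : 0 < l)
    (lam : Fin (g + 2) → ℝ) (mu : Fin (h + 2) → ℝ) (hlam : StrictMono lam) (hmu : StrictMono mu)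
    (x : Fin n → ℝ) (y : Fin m → ℝ) (hx : ∀ i, x i ∈ dom lam) (hy : ∀ j, y j ∈ dom mu)
    (F : Matrix (Fin n) (Fin m) ℝ) (α : ℝ) (hα : α ∈ Ioo (0 : ℝ) 1)
    (u v : ℕ) (hu : u ≤ k - 1) (hv : v ≤ l - 1) :
    -- the reparametrization: a coefficient matrix belongs to a spline with zero integral
    -- if and only if it is of the form `cs(B) = 𝔻 K̃ cs(C̃)`
    (∀ B : Matrix (Fin (g + k + 1)) (Fin (h + l + 1)) ℝ,
      integralΩ lam mu (tensorSpline k l lam mu B.vec) = 0 ↔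
        ∃ c : RedIdx k l g h → ℝ, B.vec = (tensorD k l lam mu * redK k l g h) *ᵥ c) ∧
    ∀ sOpt : ℝ → ℝ → ℝ,
      sOpt = tensorSpline k l lam mu
        ((tensorD k l lam mu * redK k l g h) *ᵥ optCoeff k l lam mu x y F α u v) →
      -- `sOpt` is a minimizer
      (IsTensorSpline k l lam mu sOpt ∧ integralΩ lam mu sOpt = 0 ∧
        ∀ s, IsTensorSpline k l lam mu s → integralΩ lam mu s = 0 →
          J lam mu x y F α u v sOpt ≤ J lam mu x y F α u v s) ∧
      -- and it is the only one, if no nonzero admissible spline is invisible to `J`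
      ((∀ σ, IsTensorSpline k l lam mu σ → integralΩ lam mu σ = 0 →
          (∀ i j, σ (x i) (y j) = 0) →
          integralΩ lam mu (fun x' y' => mixedDeriv lam mu u v σ x' y' ^ 2) = 0 →
          ∀ x' ∈ dom lam, ∀ y' ∈ dom mu, σ x' y' = 0) →
        ∀ s, IsTensorSpline k l lam mu s → integralΩ lam mu s = 0 →
          (∀ s', IsTensorSpline k l lam mu s' → integralΩ lam mu s' = 0 →
            J lam mu x y F α u v s ≤ J lam mu x y F α u v s') →
          ∀ x' ∈ dom lam, ∀ y' ∈ dom mu, s x' y' = sOpt x' y') := by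
  have hint : ∀ c, integralΩ lam mu (tensorSpline k l lam mu
      ((tensorD k l lam mu * redK k l g h) *ᵥ c)) = 0 := fun c =>
    (integralΩ_tensorSpline_eq_zero_iff hlam hmu hk hl _).2 ⟨c, rfl⟩
  refine ⟨fun B => integralΩ_tensorSpline_eq_zero_iff hlam hmu hk hl _, ?_⟩
  rintro sOpt rfl
  set T := tensorD k l lam mu * redK k l g h with hT
  set c₀ := optCoeff k l lam mu x y F α u v with hc₀
  have hJ := fun c => J_tensorSpline_eq_penalizedLS hlam hmu hk hl hu hv x y F α T c
  have hM := tensorM_transpose (lam := lam) (mu := mu) k l u v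
  have hM0 := tensorM_nonneg hlam hmu hk hl hu hv
  have hnormal := normalMat_mulVec_pinv (X := tensorB k l lam mu x y * T)
    (P := tensorS k l lam mu u v * T) hM hM0 hα F.vec
  rw [← optCoeff_eq] at hnormal
  have hadd := penalizedLS_eq_add hM hnormal
  have hfit : ∀ c, 0 ≤ α * (((tensorB k l lam mu x y * T) *ᵥ (c - c₀)) ⬝ᵥ
      ((tensorB k l lam mu x y * T) *ᵥ (c - c₀))) := fun c =>
    mul_nonneg hα.1.le (Finset.sum_nonneg fun _ _ => mul_self_nonneg _)
  have hpen : ∀ c, 0 ≤ (1 - α) * (((tensorS k l lam mu u v * T) *ᵥ (c - c₀)) ⬝ᵥ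
      tensorM k l lam mu u v *ᵥ ((tensorS k l lam mu u v * T) *ᵥ (c - c₀))) := fun c =>
    mul_nonneg (sub_nonneg.2 hα.2.le) (hM0 _)
  have hspline := isTensorSpline_tensorSpline hlam hmu hk hl (T *ᵥ c₀)
  refine ⟨⟨hspline, hint _, fun s hs hs0 => ?_⟩, fun hinv s hs hs0 hmin => ?_⟩
  · obtain ⟨c, hc⟩ := exists_eq_tensorSpline_of_integralΩ_eq_zero hlam hmu hk hl hs hs0
    rw [J_congr hx hy F α u v hc, hJ, hJ, hadd c]
    linarith [hfit c, hpen c]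
  · obtain ⟨c, hc⟩ := exists_eq_tensorSpline_of_integralΩ_eq_zero hlam hmu hk hl hs hs0
    have hle := hmin _ hspline (hint _)
    rw [J_congr hx hy F α u v hc, hJ, hJ, hadd c] at hle
    have h1 := (mul_eq_zero.1 (le_antisymm (by linarith [hpen c]) (hfit c))).resolve_left hα.1.ne'
    have h2 := (mul_eq_zero.1 (le_antisymm (by linarith [hfit c]) (hpen c))).resolve_left
      (sub_pos.2 hα.2).ne'
    have hσ := hinv (tensorSpline k l lam mu (T *ᵥ (c - c₀)))
      (isTensorSpline_tensorSpline hlam hmu hk hl _) (hint _) (fun i j => ?_) ?_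
    · intro x' hx' y' hy'
      have h3 := hσ x' hx' y' hy'
      rw [Matrix.mulVec_sub, tensorSpline_sub, sub_eq_zero] at h3
      rw [hc x' hx' y' hy', h3]
    · rw [← tensorSpline_data, Matrix.mulVec_mulVec, dotProduct_self_eq_zero.1 h1]
      rfl
    · rw [integralΩ_mixedDeriv_sq hlam hmu hk hl hu hv, Matrix.mulVec_mulVec]
      exact h2
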